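/- **Theorem (relaxed representation).** Let $(M,\mathfrak m)$ be a measure space (for instance a complete metric space with a Radon measure on its Borel sets), let $1<p<\infty$, and let $D(\mathcal F_p)$ be a linear subspace of $L^0(\mathfrak m)$. Let $\mathcal F_p:D(\mathcal F_p)\to L^p_+(\mathfrak m)$, $f\mapsto g_f$, be subadditive and absolutely homogeneous: $g_{f+h}\le g_f+g_h$ and $g_{\lambda f}=|\lambda| g_f$ a.e. Convergence $f_n\to f$ in $L^0(\mathfrak m)$ is understood $\mathfrak m$-almost everywhere. *The module.* Let $\mathsf{Pfm}$ be the set of countable families $s=\{(f_i,A_i)\}_{i\in\mathbb N}$ where $(A_i)$ is a measurable partition of $M$, $f_i\in D(\mathcal F_p)$ and $\sum_i\int_{A_i}g_{f_i}^p\,d\mathfrak m<\infty$; put $|s|=g_{f_i}$ on $A_i$ and $\|s\|=\||s|\|_{L^p}$, and identify $\{(f_i,A_i)\}$ with $\{(h_j,B_j)\}$ if $g_{f_i-h_j}=0$ a.e. on $A_i\cap B_j$ for all $i,j$. The module $\mathcal M=\mathcal M_{\mathcal F_p}$ is the completion of this normed space, with the multiplication by functions in $L^\infty(\mathfrak m)$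 and the pointwise norm $|\cdot|:\mathcal M\to L^p(\mathfrak m)$ extended by continuity, and $d_{\mathcal F_p}f=[f,M]$. The submodule generated by a subset is the smallest closed linear subspace that contains it and is stable under $L^\infty(\mathfrak m)$-multiplication. We call $\mathcal M$ weakly reflexive if every norm-bounded sequence $d_{\mathcal F_p}f_n$ with $f_n\in D(\mathcal F_p)$ and $f_n\to f$ for some $f\in L^0(\mathfrak m)$ has a subsequence that converges weakly in $\mathcal M$. *The lower relaxation.* Let $D(\hat{\mathcal F}_p)$ be the set of all $f\in L^0(\mathfrak m)$ with $$\inf\Big\{\liminf_{n\to\infty}\int g_{f_n}^p\,d\mathfrak m \;:\; D(\mathcal F_p)\ni f_n\to f\Big\}<\infty ,$$ and for such $f$ let $\hat{\mathcal F}_p(f)=\hat g_f$ be the greatest element of the set of all $G\in L^p(\mathfrak m)$ such that $G\le\tilde G$ a.e. whenever $D(\mathcal F_p)\ni f_n\to f$ and $g_{f_n}\rightharpoonup\tilde G$ weakly in $L^p(\mathfrak m)$. *The zero module.* Let $\mathcal M_0\subset\mathcal M$ be the submodule generated by all $\omega\in\mathcal M$ for which there are $f_n\in D(\mathcal F_p)$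 with $f_n\to0$ and $d_{\mathcal F_p}f_n\to\omega$ in $\mathcal M$. Assume that $\mathcal M$ is weakly reflexive. Then $\hat{\mathcal F}_p$ is well defined on the linear space $D(\hat{\mathcal F}_p)\supset D(\mathcal F_p)$, takes values in $L^p_+(\mathfrak m)$ and is subadditive and absolutely homogeneous, so that it generates a module $\hat{\mathcal M}=\mathcal M_{\hat{\mathcal F}_p}$. The submodule $\hat{\mathcal M}'$ of $\hat{\mathcal M}$ generated by $\{d_{\hat{\mathcal F}_p}f: f\in D(\mathcal F_p)\}$ is isometric to the quotient module, $$\hat{\mathcal M}'\;\cong\;\mathcal M/\mathcal M_0 ,$$ by a surjective linear isometry that maps $d_{\hat{\mathcal F}_p}f$ to the class of $d_{\mathcal F_p}f$ for every $f\in D(\mathcal F_p)$, commutes with multiplication by $L^\infty(\mathfrak m)$-functions, and preserves pointwise norms, where the pointwise norm of the class of $v$ is the greatest lower bound in $L^p(\mathfrak m)$ of all $|v+\omega|$, $\omega\in\mathcal M_0$. In particular, for each $f\in D(\mathcal F_p)$, $$\|d_{\hat{\mathcal F}_p}f\|_{\hat{\mathcal M}}=\inf_{\omega\in\mathcal M_0}\|d_{\mathcal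 F_p}f+\omega\|_{\mathcal M}.$$ -/

import Mathlib

open MeasureTheory Filter Topology
open scoped ENNReal

noncomputable section

/-- A subadditive, absolutely homogeneous functional `f ↦ g_f` from a linear subspace `dom` of
`L⁰(m)` to the cone of non-negative functions in `Lᵖ(m)`. -/
structure LpFunctional {M : Type*} [MeasurableSpace M] (m : Measure M) (p : ℝ≥0∞) where
  /-- the domain `D(F)` -/
  dom : Submodule ℝ (M →ₘ[m] ℝ)
  /-- the map `f ↦ g_f` -/
  g : dom → Lp ℝ p m
  g_nonneg : ∀ f, 0 ≤ g f
  g_add_le : ∀ f h, g (f + h) ≤ g f + g h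
  g_smul : ∀ (c : ℝ) (f : dom), g (c • f) = |c| • g f

/-- Weak convergence of a sequence in a real normed space. -/
def WeakTendsto {E : Type*} [NormedAddCommGroup E] [NormedSpace ℝ E] (u : ℕ → E) (v : E) : Prop :=
  ∀ ℓ : E →L[ℝ] ℝ, Tendsto (fun n => ℓ (u n)) atTop (𝓝 (ℓ v))

/-- Almost everywhere convergence of a sequence in `L⁰(m)`. -/
def AETendsto {M : Type*} [MeasurableSpace M] {m : Measure M} (u : ℕ → M →ₘ[m] ℝ)
    (f : M →ₘ[m] ℝ) : Prop :=
  ∀ᵐ x ∂m, Tendsto (fun n => u n x) atTop (𝓝 (f x))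

/-- The countably-valued measurable function `⌊(n + 1) a⌋ / (n + 1)`, uniformly close to `a`. -/
def stepApprox {M : Type*} (a : M → ℝ) (n : ℕ) (x : M) : ℝ :=
  (⌊((n : ℝ) + 1) * a x⌋ : ℝ) / ((n : ℝ) + 1)

theorem abs_stepApprox_sub_le {M : Type*} (a : M → ℝ) (n : ℕ) (x : M) :
    |stepApprox a n x - a x| ≤ 1 / ((n : ℝ) + 1) := by
  have hn : (0 : ℝ) < (n : ℝ) + 1 := by positivity
  have h1 := Int.floor_le (((n : ℝ) + 1) * a x)
  have h2 := Int.lt_floor_add_one (((n : ℝ) + 1) * a x)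
  have h3 : stepApprox a n x - a x =
      ((⌊((n : ℝ) + 1) * a x⌋ : ℝ) - ((n : ℝ) + 1) * a x) / ((n : ℝ) + 1) := by
    unfold stepApprox
    field_simp
  rw [h3, abs_div, abs_of_pos hn]
  gcongr
  rw [abs_le]
  constructor <;> linarith

namespace LpFunctional

variable {M : Type*} [MeasurableSpace M] {m : Measure M} {p : ℝ≥0∞}

theorem g_zero (F : LpFunctional m p) : F.g 0 = 0 := by
  have h := F.g_smul 0 0
  simpa using h

/-! ### The module generated by a functional -/

/-- The pointwise norm `|s|(x) = g_{s(x)}(x)` of a `D(F)`-valued function `s`. For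
`s = ∑ χ_{A_i} f_i` it equals `g_{f_i}` on `A_i`. -/
def ptNorm (F : LpFunctional m p) (s : M → F.dom) (x : M) : ℝ := F.g (s x) x

/-- `s` is of the form `∑ χ_{A_i} f_i`, where the sets `A_i = k ⁻¹' {i}` form a countable
measurable partition and `f_i ∈ D(F)`. -/
def IsStep (F : LpFunctional m p) (s : M → F.dom) : Prop :=
  ∃ (k : M → ℕ) (f : ℕ → F.dom), Measurable k ∧ s = f ∘ k

theorem IsStep.comp₂ {F : LpFunctional m p} {s t : M → F.dom} (hs : F.IsStep s) (ht : F.IsStep t)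
    (Φ : F.dom → F.dom → F.dom) : F.IsStep fun x => Φ (s x) (t x) := by
  obtain ⟨k, f, hk, rfl⟩ := hs
  obtain ⟨l, h, hl, rfl⟩ := ht
  refine ⟨fun x => Nat.pair (k x) (l x),
    fun i => Φ (f (Nat.unpair i).1) (h (Nat.unpair i).2), ?_, ?_⟩
  · exact (Measurable.of_discrete (f := fun q : ℕ × ℕ => Nat.pair q.1 q.2)).comp (hk.prodMk hl)
  · funext x
    simp

theorem IsStep.const (F : LpFunctional m p) (f : F.dom) : F.IsStep fun _ => f :=
  ⟨fun _ => 0, fun _ => f, measurable_const, rfl⟩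

/-- An almost everywhere property of the countably many values of a step function can be
tested on the values. -/
theorem IsStep.ae {F : LpFunctional m p} {s : M → F.dom} (hs : F.IsStep s)
    {P : F.dom → M → Prop} (h : ∀ f, ∀ᵐ x ∂m, P f x) : ∀ᵐ x ∂m, P (s x) x := by
  obtain ⟨k, f, hk, rfl⟩ := hs
  filter_upwards [ae_all_iff.2 fun i => h (f i)] with x hx using hx (k x)

theorem IsStep.ae₂ {F : LpFunctional m p} {s t : M → F.dom} (hs : F.IsStep s) (ht : F.IsStep t)
    {P : F.dom → F.dom → M → Prop} (h : ∀ f₁ f₂, ∀ᵐ x ∂m, P f₁ f₂ x) :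
    ∀ᵐ x ∂m, P (s x) (t x) x := by
  obtain ⟨k, f, hk, rfl⟩ := hs
  obtain ⟨l, f', hl, rfl⟩ := ht
  filter_upwards [ae_all_iff.2 fun i => ae_all_iff.2 fun j => h (f i) (f' j)] with x hx
    using hx (k x) (l x)

theorem IsStep.aestronglyMeasurable {F : LpFunctional m p} {s : M → F.dom} (hs : F.IsStep s) :
    AEStronglyMeasurable (F.ptNorm s) m := by
  obtain ⟨k, f, hk, rfl⟩ := hs
  have h : Measurable fun x => F.g (f (k x)) x := by
    have : Measurable (Function.uncurry fun (i : ℕ) (x : M) => F.g (f i) x) :=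
      measurable_from_prod_countable_right fun i => (Lp.stronglyMeasurable (F.g (f i))).measurable
    exact this.comp (hk.prodMk measurable_id)
  exact h.aestronglyMeasurable

theorem IsStep.ptNorm_nonneg {F : LpFunctional m p} {s : M → F.dom} (hs : F.IsStep s) :
    ∀ᵐ x ∂m, 0 ≤ F.ptNorm s x :=
  hs.ae (P := fun f x => 0 ≤ F.g f x) fun f => (Lp.coeFn_nonneg (F.g f)).2 (F.g_nonneg f)

theorem IsStep.ptNorm_add_le {F : LpFunctional m p} {s t : M → F.dom} (hs : F.IsStep s)
    (ht : F.IsStep t) : ∀ᵐ x ∂m, F.ptNorm (s + t) x ≤ F.ptNorm s x + F.ptNorm t x := by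
  refine hs.ae₂ ht (P := fun f h x => F.g (f + h) x ≤ F.g f x + F.g h x) fun f h => ?_
  filter_upwards [(Lp.coeFn_le _ _).2 (F.g_add_le f h), Lp.coeFn_add (F.g f) (F.g h)] with x h1 h2
  rw [h2] at h1
  exact h1

theorem g_smul_ae (F : LpFunctional m p) (c : ℝ) (f : F.dom) :
    ∀ᵐ x ∂m, F.g (c • f) x = |c| * F.g f x := by
  rw [F.g_smul]
  filter_upwards [Lp.coeFn_smul |c| (F.g f)] with x hx
  rw [hx]
  rfl

/-- A countably-valued measurable real function. -/
def IsStepReal (b : M → ℝ) : Prop :=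
  ∃ (k : M → ℤ) (c : ℤ → ℝ), Measurable k ∧ b = c ∘ k

theorem isStepReal_stepApprox {a : M → ℝ} (ha : Measurable a) (n : ℕ) :
    IsStepReal (stepApprox a n) :=
  ⟨fun x => ⌊((n : ℝ) + 1) * a x⌋, fun i => (i : ℝ) / ((n : ℝ) + 1),
    Int.measurable_floor.comp (ha.const_mul _), rfl⟩

theorem IsStep.smul {F : LpFunctional m p} {s : M → F.dom} (hs : F.IsStep s) {b : M → ℝ}
    (hb : IsStepReal b) : F.IsStep fun x => b x • s x := by
  obtain ⟨k, f, hk, rfl⟩ := hs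
  obtain ⟨l, c, hl, rfl⟩ := hb
  refine ⟨fun x => Nat.pair (k x) (Equiv.intEquivNat (l x)),
    fun i => c (Equiv.intEquivNat.symm (Nat.unpair i).2) • f (Nat.unpair i).1, ?_, ?_⟩
  · exact (Measurable.of_discrete (f := fun q : ℕ × ℤ => Nat.pair q.1 (Equiv.intEquivNat q.2))).comp
      (hk.prodMk hl)
  · funext x
    simp

theorem IsStep.ptNorm_smul {F : LpFunctional m p} {s : M → F.dom} (hs : F.IsStep s) {b : M → ℝ}
    (hb : IsStepReal b) : ∀ᵐ x ∂m, F.ptNorm (fun x => b x • s x) x = |b x| * F.ptNorm s x := by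
  obtain ⟨l, c, hl, rfl⟩ := hb
  have h : ∀ i : ℤ, ∀ᵐ x ∂m, F.g (c i • s x) x = |c i| * F.g (s x) x := fun i =>
    hs.ae (P := fun f x => F.g (c i • f) x = |c i| * F.g f x) fun f => F.g_smul_ae (c i) f
  filter_upwards [ae_all_iff.2 h] with x hx using hx (l x)

/-- The space of `∑ χ_{A_i} f_i` with `∑ ∫_{A_i} g_{f_i}^p dm < ∞`. -/
def pfmSubmodule (F : LpFunctional m p) : Submodule ℝ (M → F.dom) where
  carrier := {s | F.IsStep s ∧ MemLp (F.ptNorm s) p m}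
  zero_mem' := by
    refine ⟨IsStep.const F 0, ?_⟩
    have h : F.ptNorm (0 : M → F.dom) = fun x => (0 : Lp ℝ p m) x := by
      funext x
      simp [ptNorm, F.g_zero]
    rw [h]
    exact Lp.memLp 0
  add_mem' := by
    rintro s t ⟨hs, hs'⟩ ⟨ht, ht'⟩
    have hst : F.IsStep (s + t) := hs.comp₂ ht (· + ·)
    refine ⟨hst, (hs'.add ht').mono hst.aestronglyMeasurable ?_⟩
    filter_upwards [hs.ptNorm_add_le ht, hst.ptNorm_nonneg] with x h1 h2
    rw [Real.norm_of_nonneg h2]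
    exact h1.trans (le_abs_self _)
  smul_mem' := by
    rintro c s ⟨hs, hs'⟩
    have hcs : F.IsStep (c • s) := hs.comp₂ hs fun f _ => c • f
    refine ⟨hcs, (hs'.const_mul |c|).mono hcs.aestronglyMeasurable ?_⟩
    filter_upwards [hs.ae (P := fun f x => F.g (c • f) x = |c| * F.g f x) (F.g_smul_ae c)] with x hx
    exact (congrArg norm hx).le

/-- The space of countable families `{(f_i, A_i)}`, encoded as functions `∑ χ_{A_i} f_i`, as a type
of its own. -/
def Pfm (F : LpFunctional m p) : Type _ := F.pfmSubmodule

instance (F : LpFunctional m p) : AddCommGroup F.Pfm :=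
  inferInstanceAs (AddCommGroup F.pfmSubmodule)

instance (F : LpFunctional m p) : Module ℝ F.Pfm :=
  inferInstanceAs (Module ℝ F.pfmSubmodule)

/-- The pointwise norm of an element of `Pfm` as an element of `Lᵖ(m)`. -/
def pfmNorm (F : LpFunctional m p) (s : F.Pfm) : Lp ℝ p m :=
  MemLp.toLp (F.ptNorm s.1) s.2.2

theorem coeFn_pfmNorm (F : LpFunctional m p) (s : F.Pfm) : F.pfmNorm s =ᵐ[m] F.ptNorm s.1 :=
  MemLp.coeFn_toLp _

theorem pfmNorm_nonneg (F : LpFunctional m p) (s : F.Pfm) : 0 ≤ F.pfmNorm s := by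
  rw [← Lp.coeFn_nonneg]
  filter_upwards [F.coeFn_pfmNorm s, s.2.1.ptNorm_nonneg] with x h1 h2
  rw [h1]
  exact h2

theorem pfmNorm_add_le (F : LpFunctional m p) (s t : F.Pfm) :
    F.pfmNorm (s + t) ≤ F.pfmNorm s + F.pfmNorm t := by
  rw [← Lp.coeFn_le]
  filter_upwards [F.coeFn_pfmNorm (s + t), F.coeFn_pfmNorm s, F.coeFn_pfmNorm t,
    Lp.coeFn_add (F.pfmNorm s) (F.pfmNorm t), s.2.1.ptNorm_add_le t.2.1] with x h1 h2 h3 h4 h5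
  rw [h1, h4, Pi.add_apply, h2, h3]
  exact h5

theorem pfmNorm_smul (F : LpFunctional m p) (c : ℝ) (s : F.Pfm) :
    F.pfmNorm (c • s) = |c| • F.pfmNorm s := by
  apply Lp.ext
  filter_upwards [F.coeFn_pfmNorm (c • s), F.coeFn_pfmNorm s, Lp.coeFn_smul |c| (F.pfmNorm s),
    s.2.1.ae (P := fun f x => F.g (c • f) x = |c| * F.g f x) (F.g_smul_ae c)] with x h1 h2 h3 h4
  rw [h1, h3, Pi.smul_apply, h2]
  exact h4

set_option linter.unusedSectionVars false

variable [Fact (1 ≤ p)]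

/-- `‖s‖ = ‖ |s| ‖_{Lᵖ}`. -/
instance (F : LpFunctional m p) : Norm F.Pfm := ⟨fun s => ‖F.pfmNorm s‖⟩

theorem norm_pfm_def (F : LpFunctional m p) (s : F.Pfm) : ‖s‖ = ‖F.pfmNorm s‖ := rfl

theorem pfmCore (F : LpFunctional m p) : SeminormedSpace.Core ℝ F.Pfm where
  norm_nonneg s := norm_nonneg (F.pfmNorm s)
  norm_smul c s := by
    rw [norm_pfm_def, norm_pfm_def, pfmNorm_smul, norm_smul, Real.norm_eq_abs, abs_abs,
      Real.norm_eq_abs]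
  norm_triangle s t := by
    rw [norm_pfm_def, norm_pfm_def, norm_pfm_def]
    refine le_trans ?_ (norm_add_le (F.pfmNorm s) (F.pfmNorm t))
    apply norm_le_norm_of_abs_le_abs
    rw [abs_of_nonneg (F.pfmNorm_nonneg _),
      abs_of_nonneg (add_nonneg (F.pfmNorm_nonneg _) (F.pfmNorm_nonneg _))]
    exact F.pfmNorm_add_le s t

instance (F : LpFunctional m p) : SeminormedAddCommGroup F.Pfm :=
  SeminormedAddCommGroup.ofCore F.pfmCore

instance (F : LpFunctional m p) : NormedSpace ℝ F.Pfm :=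
  { norm_smul_le := fun c s => (F.pfmCore.norm_smul c s).le }

/-- The module generated by `F`: the completion of the seminormed space `Pfm`. The completion
identifies elements at distance `0`, i.e. it is the completion of `Pfm / ∼`, where
`s ∼ t` means that `|s - t| = 0` almost everywhere. -/
abbrev GenModule (F : LpFunctional m p) : Type _ := UniformSpace.Completion F.Pfm

/-- The element `[f, M]` of `Pfm`. -/
def const (F : LpFunctional m p) (f : F.dom) : F.Pfm :=
  ⟨fun _ => f, IsStep.const F f, Lp.memLp (F.g f)⟩

/-- The differential `d_F f = [f, M]`. -/
def d (F : LpFunctional m p) : F.dom →ₗ[ℝ] F.GenModule where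
  toFun f := ((F.const f : F.Pfm) : F.GenModule)
  map_add' f h := by
    rw [← UniformSpace.Completion.coe_add]
    rfl
  map_smul' c f := by
    rw [RingHom.id_apply, ← UniformSpace.Completion.coe_smul]
    rfl

theorem lipschitzWith_pfmNorm (F : LpFunctional m p) : LipschitzWith 1 F.pfmNorm := by
  refine LipschitzWith.of_dist_le_mul fun s t => ?_
  rw [NNReal.coe_one, one_mul, dist_eq_norm, dist_eq_norm, norm_pfm_def]
  apply norm_le_norm_of_abs_le_abs
  rw [abs_of_nonneg (F.pfmNorm_nonneg (s - t))]
  have h1 : F.pfmNorm s ≤ F.pfmNorm (s - t) + F.pfmNorm t := by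
    have h := F.pfmNorm_add_le (s - t) t
    rwa [sub_add_cancel] at h
  have h2 : F.pfmNorm t ≤ F.pfmNorm (s - t) + F.pfmNorm s := by
    have h := F.pfmNorm_add_le (-(s - t)) s
    have h' : F.pfmNorm (-(s - t)) = F.pfmNorm (s - t) := by
      have := F.pfmNorm_smul (-1) (s - t)
      simpa using this
    rw [h'] at h
    simpa using h
  refine sup_le (sub_le_iff_le_add.2 h1) ?_
  rw [neg_sub]
  exact sub_le_iff_le_add.2 h2

/-- The pointwise norm `|·| : M_F → Lᵖ(m)`, the continuous extension of the one on `Pfm`. -/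
def pnorm (F : LpFunctional m p) : F.GenModule → Lp ℝ p m :=
  UniformSpace.Completion.extension F.pfmNorm

/-- Multiplication by an essentially bounded, countably-valued measurable function `b` on `Pfm`:
`(b, {(f_i, A_i)}) ↦ {(b_j f_i, A_i ∩ B_j)}`. -/
def stepMul (F : LpFunctional m p) (b : M → ℝ) (hb : IsStepReal b) (C : ℝ)
    (hC : ∀ᵐ x ∂m, |b x| ≤ C) : F.Pfm →L[ℝ] F.Pfm :=
  LinearMap.mkContinuous
    { toFun := fun s => ⟨fun x => b x • s.1 x, s.2.1.smul hb, by
        refine MemLp.of_le_mul (c := C) s.2.2 (s.2.1.smul hb).aestronglyMeasurable ?_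
        filter_upwards [s.2.1.ptNorm_smul hb, hC] with x h1 h2
        rw [h1, norm_mul, Real.norm_eq_abs, abs_abs]
        gcongr⟩
      map_add' := fun s t => Subtype.ext (funext fun x => smul_add (b x) (s.1 x) (t.1 x))
      map_smul' := fun c s => Subtype.ext (funext fun x => smul_comm (b x) c (s.1 x)) }
    C
    (fun s => by
      refine Lp.norm_le_mul_norm_of_ae_le_mul ?_
      filter_upwards [F.coeFn_pfmNorm s, s.2.1.ptNorm_smul hb, hC,
        MemLp.coeFn_toLp (f := F.ptNorm fun x => b x • s.1 x) (p := p) (μ := m) (by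
          refine MemLp.of_le_mul (c := C) s.2.2 (s.2.1.smul hb).aestronglyMeasurable ?_
          filter_upwards [s.2.1.ptNorm_smul hb, hC] with x h1 h2
          rw [h1, norm_mul, Real.norm_eq_abs, abs_abs]
          gcongr)] with x h1 h2 h3 h4
      change ‖(MemLp.toLp (F.ptNorm fun x => b x • s.1 x) _ : Lp ℝ p m) x‖ ≤ _
      rw [h4, h2, h1, norm_mul, Real.norm_eq_abs, abs_abs]
      gcongr)

theorem abs_stepApprox_le (a : Lp ℝ ∞ m) (n : ℕ) :
    ∀ᵐ x ∂m, |stepApprox a n x| ≤ ‖a‖ + 1 / ((n : ℝ) + 1) := by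
  have h0 : ∀ᵐ x ∂m, ‖a x‖ ≤ ‖a‖ := by
    rw [Lp.norm_def, eLpNorm_exponent_top]
    have hfin : eLpNormEssSup a m ≠ ∞ := by
      rw [← eLpNorm_exponent_top]
      exact Lp.eLpNorm_ne_top a
    filter_upwards [ae_le_eLpNormEssSup (f := a) (μ := m)] with x hx
    rw [← toReal_enorm]
    exact ENNReal.toReal_mono hfin hx
  filter_upwards [h0] with x hx
  have h1 := abs_stepApprox_sub_le a n x
  have h2 := abs_sub_abs_le_abs_sub (stepApprox a n x) (a x)
  rw [Real.norm_eq_abs] at hx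
  linarith

/-- Multiplication by the `n`-th step approximation of `a ∈ L^∞(m)`. -/
def approxMul (F : LpFunctional m p) (a : Lp ℝ ∞ m) (n : ℕ) : F.Pfm →L[ℝ] F.Pfm :=
  F.stepMul (stepApprox a n) (isStepReal_stepApprox (Lp.stronglyMeasurable a).measurable n)
    (‖a‖ + 1 / ((n : ℝ) + 1)) (abs_stepApprox_le a n)

/-- Multiplication by `a ∈ L^∞(m)` on the module generated by `F`: the limit, in operator norm,
of the multiplications by countably-valued functions converging uniformly to `a`. -/
def linftyMul (F : LpFunctional m p) (a : Lp ℝ ∞ m) : F.GenModule →L[ℝ] F.GenModule :=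
  limUnder atTop fun n => (F.approxMul a n).completion

theorem norm_approxMul_sub_le (F : LpFunctional m p) (a : Lp ℝ ∞ m) (n k : ℕ) (s : F.Pfm) :
    ‖F.approxMul a n s - F.approxMul a k s‖ ≤
      (1 / ((n : ℝ) + 1) + 1 / ((k : ℝ) + 1)) * ‖s‖ := by
  refine Lp.norm_le_mul_norm_of_ae_le_mul ?_
  have h0 : ∀ᵐ x ∂m, F.ptNorm (F.approxMul a n s - F.approxMul a k s : F.Pfm).1 x =
      |stepApprox a n x - stepApprox a k x| * F.ptNorm s.1 x := by
    have h : ∀ i j : ℤ, ∀ᵐ x ∂m,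
        F.g ((((i : ℝ) / ((n : ℝ) + 1)) - ((j : ℝ) / ((k : ℝ) + 1))) • s.1 x) x =
          |((i : ℝ) / ((n : ℝ) + 1)) - ((j : ℝ) / ((k : ℝ) + 1))| * F.g (s.1 x) x := fun i j =>
      s.2.1.ae (P := fun f x => F.g ((((i : ℝ) / ((n : ℝ) + 1)) - ((j : ℝ) / ((k : ℝ) + 1))) • f) x
        = |((i : ℝ) / ((n : ℝ) + 1)) - ((j : ℝ) / ((k : ℝ) + 1))| * F.g f x) fun f =>
        F.g_smul_ae _ f
    filter_upwards [ae_all_iff.2 fun i => ae_all_iff.2 (h i)] with x hx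
    have h3 := hx ⌊((n : ℝ) + 1) * a x⌋ ⌊((k : ℝ) + 1) * a x⌋
    have h8 : (F.approxMul a n s - F.approxMul a k s : F.Pfm).1 x =
        (stepApprox a n x - stepApprox a k x) • s.1 x :=
      (sub_smul (stepApprox a n x) (stepApprox a k x) (s.1 x)).symm
    rw [ptNorm, h8]
    exact h3
  filter_upwards [F.coeFn_pfmNorm s, F.coeFn_pfmNorm (F.approxMul a n s - F.approxMul a k s), h0,
    s.2.1.ptNorm_nonneg] with x h1 h2 h3 h4
  rw [h2, h1, h3, norm_mul, Real.norm_eq_abs, abs_abs]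
  refine mul_le_mul_of_nonneg_right ?_ (norm_nonneg _)
  have h5 := abs_stepApprox_sub_le a n x
  have h6 := abs_stepApprox_sub_le a k x
  have h7 := abs_sub_le (stepApprox a n x) (a x) (stepApprox a k x)
  rw [abs_sub_comm (a x)] at h7
  linarith

theorem tendsto_linftyMul (F : LpFunctional m p) (a : Lp ℝ ∞ m) :
    Tendsto (fun n => (F.approxMul a n).completion) atTop (𝓝 (F.linftyMul a)) := by
  have hb : ∀ n k : ℕ, ‖(F.approxMul a n).completion - (F.approxMul a k).completion‖ ≤
      1 / ((n : ℝ) + 1) + 1 / ((k : ℝ) + 1) := by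
    intro n k
    refine ContinuousLinearMap.opNorm_le_bound _ (by positivity) fun v => ?_
    induction v using UniformSpace.Completion.induction_on with
    | hp =>
      exact isClosed_le (by fun_prop) (by fun_prop)
    | ih s =>
      have h := F.norm_approxMul_sub_le a n k s
      rw [sub_apply, ContinuousLinearMap.completion_apply_coe,
        ContinuousLinearMap.completion_apply_coe, ← UniformSpace.Completion.coe_sub,
        UniformSpace.Completion.norm_coe, UniformSpace.Completion.norm_coe]
      exact h
  have hc : CauchySeq fun n => (F.approxMul a n).completion := by
    refine Metric.cauchySeq_iff'.2 fun ε hε => ?_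
    obtain ⟨N, hN⟩ := exists_nat_one_div_lt (half_pos hε)
    refine ⟨N, fun n hn => ?_⟩
    rw [dist_eq_norm]
    refine lt_of_le_of_lt (hb n N) ?_
    have : 1 / ((n : ℝ) + 1) ≤ 1 / ((N : ℝ) + 1) := Nat.one_div_le_one_div hn
    linarith
  exact hc.tendsto_limUnder

/-- The submodule generated by `S`: the smallest closed linear subspace that contains `S` and is
stable under multiplication by `L^∞(m)`. -/
def moduleSpan (F : LpFunctional m p) (S : Set F.GenModule) : Submodule ℝ F.GenModule :=
  (Submodule.span ℝ {w | ∃ (a : Lp ℝ ∞ m), ∃ v ∈ S, w = F.linftyMul a v}).topologicalClosure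

instance (F : LpFunctional m p) (S : Set F.GenModule) :
    IsClosed (F.moduleSpan S : Set F.GenModule) :=
  Submodule.isClosed_topologicalClosure _

/-- The submodule generated by a set `D` of functions, i.e. by all `d_F f` with `f ∈ D(F) ∩ D`. -/
def submoduleGeneratedBy (F : LpFunctional m p) (D : Set (M →ₘ[m] ℝ)) :
    Submodule ℝ F.GenModule :=
  F.moduleSpan {w | ∃ f : F.dom, (f : M →ₘ[m] ℝ) ∈ D ∧ w = F.d f}

/-- `F` generates a weakly reflexive module: every bounded sequence `d_F f_n`, where `f_n ∈ D(F)`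
converges in `L⁰(m)`, has a weakly convergent subsequence. -/
def WeaklyReflexive (F : LpFunctional m p) : Prop :=
  ∀ (u : ℕ → F.dom) (f : M →ₘ[m] ℝ), AETendsto (fun n => (u n : M →ₘ[m] ℝ)) f →
    (∃ C : ℝ, ∀ n, ‖F.d (u n)‖ ≤ C) →
    ∃ (φ : ℕ → ℕ) (ω : F.GenModule), StrictMono φ ∧ WeakTendsto (fun n => F.d (u (φ n))) ω

/-- The set `G₀` of the strong limits of `d_F f_n` with `f_n → 0` in `L⁰(m)`. -/
def limitsAtZero (F : LpFunctional m p) : Set F.GenModule :=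
  {ω | ∃ u : ℕ → F.dom, AETendsto (fun n => (u n : M →ₘ[m] ℝ)) 0 ∧
    Tendsto (fun n => F.d (u n)) atTop (𝓝 ω)}

/-- The submodule `M₀` generated by `G₀`. -/
def zeroModule (F : LpFunctional m p) : Submodule ℝ F.GenModule :=
  F.moduleSpan F.limitsAtZero

instance (F : LpFunctional m p) : IsClosed (F.zeroModule : Set F.GenModule) :=
  inferInstanceAs (IsClosed (F.moduleSpan F.limitsAtZero : Set F.GenModule))

/-! ### The lower relaxation -/

/-- The lower semicontinuous hull of `f ↦ ∫ g_f^p dm`. -/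
def relaxedEnergy (F : LpFunctional m p) (f : M →ₘ[m] ℝ) : ℝ≥0∞ :=
  ⨅ (u : ℕ → F.dom) (_ : AETendsto (fun n => (u n : M →ₘ[m] ℝ)) f),
    liminf (fun n => ∫⁻ x, ‖F.g (u n) x‖ₑ ^ p.toReal ∂m) atTop

/-- The set of all `G ∈ Lᵖ(m)` with `G ≤ G'` whenever `f_n → f` in `L⁰(m)`, `f_n ∈ D(F)`, and
`g_{f_n}` converges weakly in `Lᵖ(m)` to `G'`. -/
def lowerBoundsAt (F : LpFunctional m p) (f : M →ₘ[m] ℝ) : Set (Lp ℝ p m) :=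
  {G | ∀ (u : ℕ → F.dom) (G' : Lp ℝ p m), AETendsto (fun n => (u n : M →ₘ[m] ℝ)) f →
    WeakTendsto (fun n => F.g (u n)) G' → G ≤ G'}

/-- `Fhat` is the lower relaxation of `F`: its domain is the set where the relaxed energy is finite,
and its value at `f` is the greatest element of `lowerBoundsAt f`. -/
structure IsLowerRelaxation (F Fhat : LpFunctional m p) : Prop where
  mem_dom : ∀ f, f ∈ Fhat.dom ↔ F.relaxedEnergy f < ∞
  isGreatest : ∀ f : Fhat.dom, IsGreatest (F.lowerBoundsAt f) (Fhat.g f)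

/-- The lower relaxation is determined by `F`. -/
theorem IsLowerRelaxation.unique {F F₁ F₂ : LpFunctional m p} (h₁ : F.IsLowerRelaxation F₁)
    (h₂ : F.IsLowerRelaxation F₂) : F₁ = F₂ := by
  obtain ⟨D₁, g₁, _, _, _⟩ := F₁
  obtain ⟨D₂, g₂, _, _, _⟩ := F₂
  obtain rfl : D₁ = D₂ := by
    ext f
    exact (h₁.mem_dom f).trans (h₂.mem_dom f).symm
  obtain rfl : g₁ = g₂ := by
    funext f
    exact (h₁.isGreatest f).unique (h₂.isGreatest f)
  rfl

end LpFunctional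
end

/-!
The relaxation and the quotient module are both described by the set of *relaxed differentials* of
`f`, that is, of the strong limits `ω` of sequences `d f_n` with `f_n → f` almost everywhere.

If `f_n → f` and `g_{f_n}` converges weakly to `G'`, then weak reflexivity provides a subsequence
with `d f_n ⇀ ω`. By Mazur's lemma `ω` is a relaxed differential of `f`
(`mem_relaxedDifferentials_of_weakTendsto`), and `|ω| ≤ G'` since the pointwise norm is weakly
lower semicontinuous (`pnorm_le_of_weakTendsto`). Hence the relaxed energy is finite exactly where
relaxed differentials exist, and the functions to be compared with in the definition of the
relaxation may be replaced by the pointwise norms `|ω|` (`mem_lowerBoundsAt_iff`).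
No weak compactness in `Lᵖ`, and no diagonal argument for almost everywhere convergence, is needed;
so the measure may be arbitrary.

The relaxed differentials of `f` form a coset `ω + G₀` of the linear space `G₀` that generates `M₀`.
A lower bound of `|ω + η|` for `η ∈ G₀` is a lower bound for `η ∈ M₀`, because a bounded function
can be approximated by constants near almost every point
(`le_pnorm_add_of_mem_zeroModule`). So `ĝ_f` is the greatest lower bound of
`{|ω + η| : η ∈ M₀}`. It exists because this set is stable under `⊓`, by gluing, and because in such
a set a sequence that minimizes the `Lᵖ` norm is Cauchy (`Lp.exists_isGLB_mem_closure`); for the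
same reason its norm is the infimum of the norms. Subadditivity and homogeneity follow from
the linearity of `f ↦ ω`.

As `ĝ_f ≤ g_f` on `D(F)`, the inclusion of the domains induces a contraction `T` of the modules,
linear over `L^∞`. It vanishes on `M₀`, and the pointwise norm of `T v` is the greatest lower bound
of `{|v + η| : η ∈ M₀}`: for `v = d f` this is the description of `ĝ_f`, for `v = ∑ χ_{A_i} f_i`
it holds by locality, and in general by density (`isGLB_pnorm_moduleMap`). Therefore
`T` induces an isometric embedding of `M / M₀`. Its range is closed, hence it is the submodule
generated by the differentials of the functions in `D(F)`.
-/

/-! ### Greatest lower bounds in `Lᵖ` -/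

namespace MeasureTheory

variable {M : Type*} [MeasurableSpace M] {m : Measure M} {p : ℝ≥0∞}

theorem Lp.enorm_rpow_eq_lintegral (hp0 : p ≠ 0) (hp : p ≠ ∞) (f : Lp ℝ p m) :
    ‖f‖ₑ ^ p.toReal = ∫⁻ x, ‖f x‖ₑ ^ p.toReal ∂m := by
  rw [Lp.enorm_def, eLpNorm_eq_lintegral_rpow_enorm_toReal hp0 hp, ← ENNReal.rpow_mul,
    one_div, inv_mul_cancel₀ (ENNReal.toReal_pos hp0 hp).ne', ENNReal.rpow_one]

instance Lp.instPosSMulMono : PosSMulMono ℝ (Lp ℝ p m) where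
  smul_le_smul_of_nonneg_left c hc a b hab := by
    rw [← Lp.coeFn_le]
    filter_upwards [(Lp.coeFn_le a b).2 hab, Lp.coeFn_smul c a, Lp.coeFn_smul c b] with x h1 h2 h3
    rw [h2, h3]
    exact mul_le_mul_of_nonneg_left h1 hc

theorem Lp.norm_le_norm_of_nonneg_of_le [Fact (1 ≤ p)] {a b : Lp ℝ p m} (ha : 0 ≤ a)
    (hab : a ≤ b) : ‖a‖ ≤ ‖b‖ := by
  apply norm_le_norm_of_abs_le_abs
  rwa [abs_of_nonneg ha, abs_of_nonneg (ha.trans hab)]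

/-- Superadditivity of the `p`-th power of the norm on non-negative functions; it is inherited
from `t ↦ t ^ p`. -/
theorem Lp.norm_sub_rpow_add_le [hp1 : Fact (1 ≤ p)] (hp : p ≠ ∞) {a b : Lp ℝ p m} (ha : 0 ≤ a)
    (hab : a ≤ b) : ‖b - a‖ ^ p.toReal + ‖a‖ ^ p.toReal ≤ ‖b‖ ^ p.toReal := by
  have hp0 : p ≠ 0 := (zero_lt_one.trans_le hp1.out).ne'
  have hq : 1 ≤ p.toReal := by
    rw [← ENNReal.toReal_one]
    exact ENNReal.toReal_mono hp hp1.out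
  have h : ‖b - a‖ₑ ^ p.toReal + ‖a‖ₑ ^ p.toReal ≤ ‖b‖ₑ ^ p.toReal := by
    simp only [Lp.enorm_rpow_eq_lintegral hp0 hp]
    refine (le_lintegral_add _ _).trans (lintegral_mono_ae ?_)
    filter_upwards [(Lp.coeFn_nonneg a).2 ha, (Lp.coeFn_le a b).2 hab, Lp.coeFn_sub b a]
      with x h1 h2 h3
    refine (ENNReal.add_rpow_le_rpow_add _ _ hq).trans_eq ?_
    rw [h3, Pi.sub_apply, Real.enorm_of_nonneg (sub_nonneg.2 h2), Real.enorm_of_nonneg h1,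
      Real.enorm_of_nonneg (le_trans h1 h2), ← ENNReal.ofReal_add (sub_nonneg.2 h2) h1,
      sub_add_cancel]
  simp only [← ofReal_norm, ENNReal.ofReal_rpow_of_nonneg (norm_nonneg _) (zero_le_one.trans hq)]
    at h
  rw [← ENNReal.ofReal_add (by positivity) (by positivity)] at h
  exact (ENNReal.ofReal_le_ofReal_iff (by positivity)).1 h

/-- A set of non-negative `Lᵖ` functions which is stable under `⊓` has a greatest lower bound, and
this bound is a limit of elements of the set: a sequence that minimizes the norm is Cauchy. -/
theorem Lp.exists_isGLB_mem_closure [hp1 : Fact (1 ≤ p)] (hp : p ≠ ∞) {S : Set (Lp ℝ p m)}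
    (hne : S.Nonempty) (h0 : ∀ s ∈ S, 0 ≤ s) (hinf : ∀ s ∈ S, ∀ t ∈ S, s ⊓ t ∈ S) :
    ∃ G ∈ closure S, IsGLB S G := by
  have hp0 : p ≠ 0 := (zero_lt_one.trans_le hp1.out).ne'
  have hq : 0 < p.toReal := ENNReal.toReal_pos hp0 hp
  set N : Set ℝ := (fun s : Lp ℝ p m => ‖s‖ ^ p.toReal) '' S with hN
  have hbdd : BddBelow N := ⟨0, by rintro _ ⟨s, -, rfl⟩; positivity⟩
  have hex : ∀ n : ℕ, ∃ s ∈ S, ‖s‖ ^ p.toReal < sInf N + 1 / ((n : ℝ) + 1) := by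
    intro n
    obtain ⟨_, ⟨s, hs, rfl⟩, h⟩ := exists_lt_of_csInf_lt (hne.image _)
      (lt_add_of_pos_right (sInf N) (Nat.one_div_pos_of_nat (α := ℝ) (n := n)))
    exact ⟨s, hs, h⟩
  choose s hs hlt using hex
  -- `e n` is the `p`-th root of a bound for the distance of `‖s n‖ ^ p` from its infimum.
  set e : ℕ → ℝ := fun n => (1 / ((n : ℝ) + 1)) ^ (1 / p.toReal) with he
  have hde : ∀ n, ∀ t ∈ S, ‖s n - s n ⊓ t‖ ≤ e n := by
    intro n t ht
    have h1 := Lp.norm_sub_rpow_add_le hp (le_inf (h0 _ (hs n)) (h0 t ht))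
      (inf_le_left : s n ⊓ t ≤ s n)
    have h2 : sInf N ≤ ‖s n ⊓ t‖ ^ p.toReal := csInf_le hbdd ⟨_, hinf _ (hs n) _ ht, rfl⟩
    have h3 : ‖s n - s n ⊓ t‖ ^ p.toReal ≤ 1 / ((n : ℝ) + 1) := by linarith [hlt n]
    rw [he, one_div p.toReal]
    exact (Real.le_rpow_inv_iff_of_pos (norm_nonneg _) (by positivity) hq).2 h3
  have he0 : Tendsto e atTop (𝓝 0) := by
    have h := (tendsto_one_div_add_atTop_nhds_zero_nat (𝕜 := ℝ)).rpow_const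
      (p := 1 / p.toReal) (Or.inr (by positivity))
    rwa [Real.zero_rpow (by positivity)] at h
  have hanti : ∀ k n, k ≤ n → e n ≤ e k := fun k n hkn =>
    Real.rpow_le_rpow (by positivity) (Nat.one_div_le_one_div hkn) (by positivity)
  have hc : CauchySeq s := by
    refine cauchySeq_of_le_tendsto_0 (fun n => e n + e n) (fun n k l hn hk => ?_)
      (by simpa using he0.add he0)
    have h1 := hde n _ (hs k)
    have h2 := hde k _ (hs n)
    rw [inf_comm, ← _root_.dist_eq_norm] at h2
    rw [← _root_.dist_eq_norm] at h1
    exact (dist_triangle_right _ _ _).trans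
      (add_le_add (h1.trans (hanti _ _ hn)) (h2.trans (hanti _ _ hk)))
  obtain ⟨G, hG⟩ := cauchySeq_tendsto_of_complete hc
  refine ⟨G, mem_closure_of_tendsto hG (Eventually.of_forall hs), fun t ht => ?_, fun L hL =>
    ge_of_tendsto' hG fun n => hL (hs n)⟩
  have h1 : Tendsto (fun n => s n - s n ⊓ t) atTop (𝓝 (G - G ⊓ t)) :=
    hG.sub (((continuous_id.inf continuous_const).tendsto G).comp hG)
  have h2 : Tendsto (fun n => s n - s n ⊓ t) atTop (𝓝 0) :=
    squeeze_zero_norm (fun n => hde n t ht) he0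
  rw [← inf_eq_left]
  exact (sub_eq_zero.1 (tendsto_nhds_unique h1 h2)).symm

/-- The infimum of the norms is the norm of the infimum, if the latter is a limit. -/
theorem Lp.isGLB_norm_image [Fact (1 ≤ p)] {S : Set (Lp ℝ p m)} {G : Lp ℝ p m}
    (h0 : ∀ s ∈ S, 0 ≤ s) (hG : IsGLB S G) (hcl : G ∈ closure S) :
    IsGLB (norm '' S) ‖G‖ := by
  refine ⟨?_, fun c hc => ?_⟩
  · rintro _ ⟨s, hs, rfl⟩
    exact Lp.norm_le_norm_of_nonneg_of_le (hG.2 h0) (hG.1 hs)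
  · have : closure S ⊆ {x | c ≤ ‖x‖} :=
      closure_minimal (fun s hs => hc ⟨s, hs, rfl⟩) (isClosed_le continuous_const continuous_norm)
    exact this hcl

theorem Lp.ae_abs_le_norm (a : Lp ℝ ∞ m) : ∀ᵐ x ∂m, |a x| ≤ ‖a‖ := by
  have hfin : eLpNormEssSup a m ≠ ∞ := by
    rw [← eLpNorm_exponent_top]
    exact Lp.eLpNorm_ne_top a
  rw [Lp.norm_def, eLpNorm_exponent_top]
  filter_upwards [ae_le_eLpNormEssSup (f := a) (μ := m)] with x hx
  rw [← Real.norm_eq_abs, ← toReal_enorm]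
  exact ENNReal.toReal_mono hfin hx

end MeasureTheory

/-! ### Weak limits and convex combinations -/

/-- A closed convex set contains the weak limits of its sequences. -/
theorem WeakTendsto.mem_of_isClosed_of_convex {E : Type*} [NormedAddCommGroup E] [NormedSpace ℝ E]
    {u : ℕ → E} {v : E} (h : WeakTendsto u v) {C : Set E} (hcl : IsClosed C) (hC : Convex ℝ C)
    (hu : ∀ᶠ n in atTop, u n ∈ C) : v ∈ C := by
  by_contra hv
  obtain ⟨ℓ, c, h1, h2⟩ := geometric_hahn_banach_closed_point hC hcl hv
  exact absurd (le_of_tendsto (h ℓ) (hu.mono fun n hn => (h1 _ hn).le)) (not_le.2 h2)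

theorem WeakTendsto.prodMk {E E' : Type*} [NormedAddCommGroup E] [NormedSpace ℝ E]
    [NormedAddCommGroup E'] [NormedSpace ℝ E'] {u : ℕ → E} {v : E} {u' : ℕ → E'} {v' : E'}
    (h : WeakTendsto u v) (h' : WeakTendsto u' v') :
    WeakTendsto (fun n => (u n, u' n)) (v, v') := by
  intro ℓ
  have h1 := (h (ℓ.comp (ContinuousLinearMap.inl ℝ E E'))).add
    (h' (ℓ.comp (ContinuousLinearMap.inr ℝ E E')))
  simpa [← map_add] using h1

theorem WeakTendsto.comp {E : Type*} [NormedAddCommGroup E] [NormedSpace ℝ E]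
    {u : ℕ → E} {v : E} (h : WeakTendsto u v) {φ : ℕ → ℕ} (hφ : Tendsto φ atTop atTop) :
    WeakTendsto (fun n => u (φ n)) v :=
  fun ℓ => (h ℓ).comp hφ

theorem weakTendsto_of_tendsto {E : Type*} [NormedAddCommGroup E] [NormedSpace ℝ E]
    {u : ℕ → E} {v : E} (h : Tendsto u atTop (𝓝 v)) : WeakTendsto u v :=
  fun ℓ => (ℓ.continuous.tendsto v).comp h

/-- Weakly convergent sequences are bounded, by the uniform boundedness principle applied in the
bidual. -/
theorem WeakTendsto.exists_norm_le {E : Type*} [NormedAddCommGroup E] [NormedSpace ℝ E]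
    {u : ℕ → E} {v : E} (h : WeakTendsto u v) : ∃ C : ℝ, ∀ n, ‖u n‖ ≤ C := by
  obtain ⟨C, hC⟩ := banach_steinhaus (g := fun n => NormedSpace.inclusionInDoubleDual ℝ E (u n))
    fun ℓ => by
      obtain ⟨c, hc⟩ := (h ℓ).norm.bddAbove_range
      exact ⟨c, fun n => hc ⟨n, rfl⟩⟩
  refine ⟨C, fun n => ?_⟩
  rw [← (NormedSpace.inclusionInDoubleDualLi ℝ (E := E)).norm_map (u n)]
  exact hC n

namespace LpFunctional

variable {M : Type*} [MeasurableSpace M] {m : Measure M} {p : ℝ≥0∞} [Fact (1 ≤ p)]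

/-! ### The pointwise norm -/

theorem continuous_pnorm (F : LpFunctional m p) : Continuous F.pnorm :=
  UniformSpace.Completion.continuous_extension

theorem pnorm_coe (F : LpFunctional m p) (s : F.Pfm) : F.pnorm (s : F.GenModule) = F.pfmNorm s :=
  UniformSpace.Completion.extension_coe F.lipschitzWith_pfmNorm.uniformContinuous s

theorem norm_pnorm (F : LpFunctional m p) (v : F.GenModule) : ‖F.pnorm v‖ = ‖v‖ := by
  induction v using UniformSpace.Completion.induction_on with
  | hp => exact isClosed_eq F.continuous_pnorm.norm continuous_norm
  | ih s => rw [pnorm_coe, UniformSpace.Completion.norm_coe, norm_pfm_def]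

theorem pnorm_nonneg (F : LpFunctional m p) (v : F.GenModule) : 0 ≤ F.pnorm v := by
  induction v using UniformSpace.Completion.induction_on with
  | hp => exact isClosed_le continuous_const F.continuous_pnorm
  | ih s =>
    rw [pnorm_coe]
    exact F.pfmNorm_nonneg s

theorem pnorm_add_le (F : LpFunctional m p) (v w : F.GenModule) :
    F.pnorm (v + w) ≤ F.pnorm v + F.pnorm w := by
  induction v, w using UniformSpace.Completion.induction_on₂ with
  | hp =>
    exact isClosed_le (F.continuous_pnorm.comp continuous_add)
      ((F.continuous_pnorm.comp continuous_fst).add (F.continuous_pnorm.comp continuous_snd))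
  | ih s t =>
    rw [← UniformSpace.Completion.coe_add, pnorm_coe, pnorm_coe, pnorm_coe]
    exact F.pfmNorm_add_le s t

theorem pnorm_smul (F : LpFunctional m p) (c : ℝ) (v : F.GenModule) :
    F.pnorm (c • v) = |c| • F.pnorm v := by
  induction v using UniformSpace.Completion.induction_on with
  | hp =>
    exact isClosed_eq (F.continuous_pnorm.comp (continuous_const_smul c))
      (F.continuous_pnorm.const_smul |c|)
  | ih s => rw [← UniformSpace.Completion.coe_smul, pnorm_coe, pnorm_coe, pfmNorm_smul]

theorem pnorm_le_add_sub (F : LpFunctional m p) (v w : F.GenModule) :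
    F.pnorm v ≤ F.pnorm w + F.pnorm (v - w) := by
  have h := F.pnorm_add_le w (v - w)
  rwa [add_sub_cancel] at h

theorem pnorm_d (F : LpFunctional m p) (f : F.dom) : F.pnorm (F.d f) = F.g f :=
  (F.pnorm_coe (F.const f)).trans (Lp.toLp_coeFn (F.g f) _)

theorem norm_d (F : LpFunctional m p) (f : F.dom) : ‖F.d f‖ = ‖F.g f‖ := by
  rw [← norm_pnorm, pnorm_d]

/-! ### Multiplication by bounded functions -/

theorem IsStepReal.comp₂ {b c : M → ℝ} (hb : IsStepReal b) (hc : IsStepReal c)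
    (Φ : ℝ → ℝ → ℝ) : IsStepReal fun x => Φ (b x) (c x) := by
  obtain ⟨k, f, hk, rfl⟩ := hb
  obtain ⟨l, h, hl, rfl⟩ := hc
  refine ⟨fun x => (Nat.pair (Equiv.intEquivNat (k x)) (Equiv.intEquivNat (l x)) : ℕ),
    fun i => Φ (f (Equiv.intEquivNat.symm (Nat.unpair i.toNat).1))
      (h (Equiv.intEquivNat.symm (Nat.unpair i.toNat).2)), ?_, ?_⟩
  · exact (Measurable.of_discrete (f := fun q : ℤ × ℤ =>
      ((Nat.pair (Equiv.intEquivNat q.1) (Equiv.intEquivNat q.2) : ℕ) : ℤ))).comp (hk.prodMk hl)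
  · funext x
    simp

theorem isStepReal_indicator {A : Set M} (hA : MeasurableSet A) :
    IsStepReal (A.indicator fun _ => (1 : ℝ)) := by
  refine ⟨A.indicator fun _ => 1, fun i => i, measurable_const.indicator hA, ?_⟩
  funext x
  by_cases hx : x ∈ A <;> simp [hx]

theorem isStepReal_const (c : ℝ) : IsStepReal fun _ : M => c :=
  ⟨fun _ => 0, fun _ => c, measurable_const, rfl⟩

omit [Fact (1 ≤ p)] in
theorem coeFn_pfmNorm_of_eq_smul (F : LpFunctional m p) {s t : F.Pfm} {b : M → ℝ}
    (hb : IsStepReal b) (h : ∀ x, t.1 x = b x • s.1 x) :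
    ∀ᵐ x ∂m, F.pfmNorm t x = |b x| * F.pfmNorm s x := by
  filter_upwards [F.coeFn_pfmNorm t, F.coeFn_pfmNorm s, s.2.1.ptNorm_smul hb] with x h1 h2 h3
  rw [h1, h2, ← h3, ptNorm, ptNorm, h]

omit [Fact (1 ≤ p)] in
theorem norm_le_of_eq_smul (F : LpFunctional m p) {s t : F.Pfm} {b : M → ℝ} (hb : IsStepReal b)
    (h : ∀ x, t.1 x = b x • s.1 x) {δ : ℝ} (hδ : ∀ᵐ x ∂m, |b x| ≤ δ) : ‖t‖ ≤ δ * ‖s‖ := by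
  refine Lp.norm_le_mul_norm_of_ae_le_mul ?_
  filter_upwards [F.coeFn_pfmNorm_of_eq_smul hb h, hδ] with x h1 h2
  rw [h1, norm_mul, Real.norm_eq_abs, abs_abs]
  gcongr

theorem tendsto_approxMul (F : LpFunctional m p) (a : Lp ℝ ∞ m) (s : F.Pfm) :
    Tendsto (fun n => ((F.approxMul a n s : F.Pfm) : F.GenModule)) atTop
      (𝓝 (F.linftyMul a s)) := by
  have h := ((continuous_fst.clm_apply continuous_snd).tendsto
    (F.linftyMul a, (s : F.GenModule))).comp
      ((F.tendsto_linftyMul a).prodMk_nhds tendsto_const_nhds)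
  simpa only [Function.comp_def, ContinuousLinearMap.completion_apply_coe] using h

/-- The product `a s` can be computed with any countably-valued functions converging uniformly to
`a`. -/
theorem tendsto_of_eq_smul (F : LpFunctional m p) (a : Lp ℝ ∞ m) (s : F.Pfm) {b : ℕ → M → ℝ}
    (hb : ∀ n, IsStepReal (b n)) {ε : ℕ → ℝ} (hε : Tendsto ε atTop (𝓝 0))
    (hba : ∀ n, ∀ᵐ x ∂m, |b n x - a x| ≤ ε n) {t : ℕ → F.Pfm}
    (ht : ∀ n x, (t n).1 x = b n x • s.1 x) :
    Tendsto (fun n => (t n : F.GenModule)) atTop (𝓝 (F.linftyMul a s)) := by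
  have h0 : Tendsto (fun n : ℕ => (ε n + 1 / ((n : ℝ) + 1)) * ‖s‖) atTop (𝓝 0) := by
    have := (hε.add (tendsto_one_div_add_atTop_nhds_zero_nat (𝕜 := ℝ))).mul_const ‖s‖
    simpa using this
  have h1 : Tendsto (fun n => (t n : F.GenModule) - (F.approxMul a n s : F.Pfm)) atTop (𝓝 0) := by
    refine squeeze_zero_norm (fun n => ?_) h0
    rw [← UniformSpace.Completion.coe_sub, UniformSpace.Completion.norm_coe]
    refine F.norm_le_of_eq_smul (b := fun x => b n x - stepApprox a n x)
      ((hb n).comp₂ (isStepReal_stepApprox (Lp.stronglyMeasurable a).measurable n) (· - ·))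
      (fun x => ?_) ?_
    · exact (congrArg (· - (F.approxMul a n s).1 x) (ht n x)).trans (sub_smul _ _ _).symm
    · filter_upwards [hba n] with x hx
      have h2 := abs_stepApprox_sub_le a n x
      have h3 := abs_sub_le (b n x) (a x) (stepApprox a n x)
      rw [abs_sub_comm (a x)] at h3
      linarith
  have h2 := h1.add (F.tendsto_approxMul a s)
  simpa using h2

/-- The product of `a` and `s` for a countably-valued function `a`. -/
theorem linftyMul_coe_of_ae_eq (F : LpFunctional m p) {a : Lp ℝ ∞ m} {s t : F.Pfm} {b : M → ℝ}
    (hb : IsStepReal b) (hba : a =ᵐ[m] b) (ht : ∀ x, t.1 x = b x • s.1 x) :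
    F.linftyMul a s = t := by
  refine tendsto_nhds_unique (F.tendsto_of_eq_smul a s (fun _ => hb) (ε := fun _ => 0)
    tendsto_const_nhds (fun _ => ?_) (t := fun _ => t) fun _ => ht) tendsto_const_nhds
  filter_upwards [hba] with x hx
  simp [hx]

theorem linftyMul_add (F : LpFunctional m p) (a b : Lp ℝ ∞ m) (v : F.GenModule) :
    F.linftyMul (a + b) v = F.linftyMul a v + F.linftyMul b v := by
  induction v using UniformSpace.Completion.induction_on with
  | hp => exact isClosed_eq (by fun_prop) (by fun_prop)
  | ih s =>
    have hlim : Tendsto (fun n : ℕ => 1 / ((n : ℝ) + 1) + 1 / ((n : ℝ) + 1)) atTop (𝓝 0) := by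
      have h := tendsto_one_div_add_atTop_nhds_zero_nat (𝕜 := ℝ)
      simpa using h.add h
    refine tendsto_nhds_unique (F.tendsto_of_eq_smul (a + b) s
      (b := fun n x => stepApprox a n x + stepApprox b n x)
      (fun n => (isStepReal_stepApprox (Lp.stronglyMeasurable a).measurable n).comp₂
        (isStepReal_stepApprox (Lp.stronglyMeasurable b).measurable n) (· + ·))
      hlim
      (fun n => ?_) (t := fun n => F.approxMul a n s + F.approxMul b n s) fun n x => ?_) ?_
    · filter_upwards [Lp.coeFn_add a b] with x hx
      rw [hx, Pi.add_apply, add_sub_add_comm]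
      exact (abs_add_le _ _).trans
        (add_le_add (abs_stepApprox_sub_le a n x) (abs_stepApprox_sub_le b n x))
    · exact (add_smul _ _ _).symm
    · simp only [UniformSpace.Completion.coe_add]
      exact (F.tendsto_approxMul a s).add (F.tendsto_approxMul b s)

theorem linftyMul_mul (F : LpFunctional m p) (a b : Lp ℝ ∞ m) (v : F.GenModule) :
    F.linftyMul (a • b : Lp ℝ ∞ m) v = F.linftyMul a (F.linftyMul b v) := by
  induction v using UniformSpace.Completion.induction_on with
  | hp => exact isClosed_eq (by fun_prop) (by fun_prop)
  | ih s =>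
    have hlim := tendsto_one_div_add_atTop_nhds_zero_nat (𝕜 := ℝ)
    refine tendsto_nhds_unique (F.tendsto_of_eq_smul (a • b : Lp ℝ ∞ m) s
      (b := fun n x => stepApprox a n x * stepApprox b n x)
      (fun n => (isStepReal_stepApprox (Lp.stronglyMeasurable a).measurable n).comp₂
        (isStepReal_stepApprox (Lp.stronglyMeasurable b).measurable n) (· * ·))
      (ε := fun n => (‖a‖ + 1 / ((n : ℝ) + 1)) * (1 / ((n : ℝ) + 1)) + 1 / ((n : ℝ) + 1) * ‖b‖)
      (by simpa using ((hlim.const_add ‖a‖).mul hlim).add (hlim.mul_const ‖b‖))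
      (fun n => ?_) (t := fun n => F.approxMul a n (F.approxMul b n s)) fun n x => ?_) ?_
    · filter_upwards [Lp.coeFn_lpSMul (r := ∞) a b, abs_stepApprox_le a n, Lp.ae_abs_le_norm b]
        with x hx h1 h2
      have h3 : stepApprox a n x * stepApprox b n x - a x * b x =
          stepApprox a n x * (stepApprox b n x - b x) + (stepApprox a n x - a x) * b x := by ring
      rw [hx, Pi.smul_apply', smul_eq_mul, h3]
      refine (abs_add_le _ _).trans (add_le_add ?_ ?_)
      · rw [abs_mul]
        exact mul_le_mul h1 (abs_stepApprox_sub_le b n x) (abs_nonneg _) (by positivity)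
      · rw [abs_mul]
        exact mul_le_mul (abs_stepApprox_sub_le a n x) h2 (abs_nonneg _) (by positivity)
    · exact (mul_smul _ _ _).symm
    · have h := ((continuous_fst.clm_apply continuous_snd).tendsto
        (F.linftyMul a, F.linftyMul b s)).comp
          ((F.tendsto_linftyMul a).prodMk_nhds (F.tendsto_approxMul b s))
      simpa only [Function.comp_def, ContinuousLinearMap.completion_apply_coe] using h

/-- The function `c χ_A` as an element of `L^∞(m)`. The set `A` may have infinite measure. -/
noncomputable def linftyIndicator (m : Measure M) {A : Set M} (hA : MeasurableSet A) (c : ℝ) :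
    Lp ℝ ∞ m :=
  (memLp_top_of_bound (f := A.indicator fun _ => c)
    (measurable_const.indicator hA).aestronglyMeasurable |c|
    (Eventually.of_forall fun x => by
      by_cases hx : x ∈ A <;> simp [hx])).toLp _

theorem coeFn_linftyIndicator {A : Set M} (hA : MeasurableSet A) (c : ℝ) :
    linftyIndicator m hA c =ᵐ[m] A.indicator fun _ => c :=
  MemLp.coeFn_toLp _

theorem linftyMul_univ (F : LpFunctional m p) (c : ℝ) (v : F.GenModule) :
    F.linftyMul (linftyIndicator m .univ c) v = c • v := by
  induction v using UniformSpace.Completion.induction_on with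
  | hp => exact isClosed_eq (F.linftyMul _).continuous (continuous_const_smul c)
  | ih s =>
    rw [← UniformSpace.Completion.coe_smul]
    refine F.linftyMul_coe_of_ae_eq (isStepReal_const c) ?_ fun x => rfl
    simpa using coeFn_linftyIndicator (m := m) .univ c

theorem pnorm_linftyMul (F : LpFunctional m p) (a : Lp ℝ ∞ m) (v : F.GenModule) :
    F.pnorm (F.linftyMul a v) = (|a| • F.pnorm v : Lp ℝ p m) := by
  have hcont : Continuous fun h : Lp ℝ p m => (|a| • h : Lp ℝ p m) := by
    refine LipschitzWith.continuous (K := ‖a‖₊) (LipschitzWith.of_dist_le_mul fun h h' => ?_)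
    rw [dist_eq_norm, dist_eq_norm, sub_eq_add_neg, ← Lp.smul_neg, ← Lp.add_smul,
      ← sub_eq_add_neg, coe_nnnorm, ← norm_abs_eq_norm a]
    exact Lp.norm_smul_le _ _
  induction v using UniformSpace.Completion.induction_on with
  | hp =>
    exact isClosed_eq (F.continuous_pnorm.comp (F.linftyMul a).continuous)
      (hcont.comp F.continuous_pnorm)
  | ih s =>
    refine tendsto_nhds_unique ((F.continuous_pnorm.tendsto _).comp (F.tendsto_approxMul a s)) ?_
    rw [← tendsto_sub_nhds_zero_iff]
    refine squeeze_zero_norm (a := fun n : ℕ => 1 / ((n : ℝ) + 1) * ‖F.pnorm s‖) (fun n => ?_) ?_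
    · refine Lp.norm_le_mul_norm_of_ae_le_mul ?_
      rw [Function.comp_apply, pnorm_coe, pnorm_coe]
      filter_upwards [Lp.coeFn_sub (F.pfmNorm (F.approxMul a n s)) (|a| • F.pfmNorm s),
        Lp.coeFn_lpSMul (r := p) |a| (F.pfmNorm s), Lp.coeFn_abs a,
        F.coeFn_pfmNorm_of_eq_smul (isStepReal_stepApprox (Lp.stronglyMeasurable a).measurable n)
          (s := s) (t := F.approxMul a n s) fun x => rfl] with x h1 h2 h3 h4
      rw [h1, Pi.sub_apply, h2, h4, Pi.smul_apply', h3, smul_eq_mul, ← sub_mul, norm_mul]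
      exact mul_le_mul_of_nonneg_right
        ((abs_abs_sub_abs_le_abs_sub _ _).trans (abs_stepApprox_sub_le a n x)) (norm_nonneg _)
    · simpa using (tendsto_one_div_add_atTop_nhds_zero_nat (𝕜 := ℝ)).mul_const ‖F.pnorm s‖

theorem coeFn_pnorm_linftyMul (F : LpFunctional m p) (a : Lp ℝ ∞ m) (v : F.GenModule) :
    ∀ᵐ x ∂m, F.pnorm (F.linftyMul a v) x = |a x| * F.pnorm v x := by
  rw [pnorm_linftyMul]
  filter_upwards [Lp.coeFn_lpSMul (r := p) |a| (F.pnorm v), Lp.coeFn_abs a] with x h1 h2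
  rw [h1, Pi.smul_apply', h2, smul_eq_mul]

theorem coeFn_pnorm_linftyIndicator (F : LpFunctional m p) {A : Set M} (hA : MeasurableSet A)
    (v : F.GenModule) :
    ∀ᵐ x ∂m, F.pnorm (F.linftyMul (linftyIndicator m hA 1) v) x =
      A.indicator (fun x => F.pnorm v x) x := by
  filter_upwards [F.coeFn_pnorm_linftyMul (linftyIndicator m hA 1) v,
    coeFn_linftyIndicator (m := m) hA 1] with x h1 h2
  rw [h1, h2]
  by_cases hx : x ∈ A <;> simp [hx]

/-- Locality of the pointwise norm. -/
theorem pnorm_ae_eq_of_linftyIndicator_eq (F : LpFunctional m p) {A : Set M}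
    (hA : MeasurableSet A) {v w : F.GenModule}
    (h : F.linftyMul (linftyIndicator m hA 1) v = F.linftyMul (linftyIndicator m hA 1) w) :
    ∀ᵐ x ∂m, x ∈ A → F.pnorm v x = F.pnorm w x := by
  filter_upwards [F.coeFn_pnorm_linftyIndicator hA v, F.coeFn_pnorm_linftyIndicator hA w]
    with x h1 h2 hx
  rw [h, h2] at h1
  simpa [hx] using h1.symm

theorem norm_linftyMul_le (F : LpFunctional m p) (a : Lp ℝ ∞ m) (v : F.GenModule) :
    ‖F.linftyMul a v‖ ≤ ‖a‖ * ‖v‖ := by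
  rw [← norm_pnorm, ← norm_pnorm F v, pnorm_linftyMul, ← norm_abs_eq_norm a]
  exact Lp.norm_smul_le _ _

/-- Gluing: the pointwise minimum of `|v|` and `|w|` is the pointwise norm of
`χ_A v + χ_{Aᶜ} w`, where `A = {|v| ≤ |w|}`. -/
theorem exists_pnorm_eq_inf (F : LpFunctional m p) (v w : F.GenModule) :
    ∃ a b : Lp ℝ ∞ m, a + b = linftyIndicator m .univ 1 ∧
      F.pnorm (F.linftyMul a v + F.linftyMul b w) = F.pnorm v ⊓ F.pnorm w := by
  set A : Set M := {x | F.pnorm v x ≤ F.pnorm w x}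
  have hA : MeasurableSet A := measurableSet_le (Lp.stronglyMeasurable _).measurable
    (Lp.stronglyMeasurable _).measurable
  set a := linftyIndicator m hA 1
  set b := linftyIndicator m hA.compl 1
  have ha : a =ᵐ[m] _ := coeFn_linftyIndicator hA 1
  have hb : b =ᵐ[m] _ := coeFn_linftyIndicator hA.compl 1
  have hmul : ∀ c d e : Lp ℝ ∞ m, (∀ᵐ x ∂m, c x * d x = e x) → (c • d : Lp ℝ ∞ m) = e := by
    intro c d e h
    apply Lp.ext
    filter_upwards [Lp.coeFn_lpSMul (r := ∞) c d, h] with x h1 h2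
    rw [h1, ← h2]
    rfl
  have haa : (a • a : Lp ℝ ∞ m) = a := hmul _ _ _ <| by
    filter_upwards [ha] with x h1
    rw [h1]
    by_cases hx : x ∈ A <;> simp [hx]
  have hbb : (b • b : Lp ℝ ∞ m) = b := hmul _ _ _ <| by
    filter_upwards [hb] with x h1
    rw [h1]
    by_cases hx : x ∈ A <;> simp [hx]
  have hab : (a • b : Lp ℝ ∞ m) = 0 := hmul _ _ _ <| by
    filter_upwards [ha, hb, Lp.coeFn_zero ℝ ∞ m] with x h1 h2 h3
    rw [h1, h2, h3]
    by_cases hx : x ∈ A <;> simp [hx]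
  have hba : (b • a : Lp ℝ ∞ m) = 0 := hmul _ _ _ <| by
    filter_upwards [ha, hb, Lp.coeFn_zero ℝ ∞ m] with x h1 h2 h3
    rw [h1, h2, h3]
    by_cases hx : x ∈ A <;> simp [hx]
  have hzero : ∀ u : F.GenModule, F.linftyMul 0 u = 0 := fun u => by
    have h := F.norm_linftyMul_le 0 u
    rw [norm_zero, zero_mul] at h
    exact norm_le_zero_iff.1 h
  refine ⟨a, b, ?_, Lp.ext ?_⟩
  · apply Lp.ext
    filter_upwards [ha, hb, Lp.coeFn_add a b, coeFn_linftyIndicator (m := m) .univ 1]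
      with x h1 h2 h3 h4
    rw [h3, h4, Pi.add_apply, h1, h2]
    by_cases hx : x ∈ A <;> simp [hx]
  · filter_upwards [F.pnorm_ae_eq_of_linftyIndicator_eq hA (v := F.linftyMul a v + F.linftyMul b w)
        (w := v) (by rw [map_add, ← linftyMul_mul, ← linftyMul_mul, haa, hab, hzero, add_zero]),
      F.pnorm_ae_eq_of_linftyIndicator_eq hA.compl (v := F.linftyMul a v + F.linftyMul b w)
        (w := w) (by rw [map_add, ← linftyMul_mul, ← linftyMul_mul, hbb, hba, hzero, zero_add]),
      Lp.coeFn_inf (F.pnorm v) (F.pnorm w)] with x h1 h2 h3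
    rw [h3, Pi.inf_apply]
    by_cases hx : x ∈ A
    · rw [h1 hx]
      exact (inf_eq_left.2 hx).symm
    · rw [h2 hx]
      exact (inf_eq_right.2 (le_of_not_ge hx)).symm

end LpFunctional

/-! ### Relaxed differentials -/

section AETendsto

variable {M : Type*} [MeasurableSpace M] {m : Measure M}

theorem AETendsto.const (f : M →ₘ[m] ℝ) : AETendsto (fun _ => f) f :=
  Eventually.of_forall fun _ => tendsto_const_nhds

theorem AETendsto.add {u v : ℕ → M →ₘ[m] ℝ} {f h : M →ₘ[m] ℝ} (hu : AETendsto u f)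
    (hv : AETendsto v h) : AETendsto (fun n => u n + v n) (f + h) := by
  filter_upwards [hu, hv, AEEqFun.coeFn_add f h,
    ae_all_iff.2 fun n => AEEqFun.coeFn_add (u n) (v n)]
    with x h1 h2 h3 h4
  simpa only [h3, h4, Pi.add_apply] using h1.add h2

theorem AETendsto.const_smul {u : ℕ → M →ₘ[m] ℝ} {f : M →ₘ[m] ℝ} (hu : AETendsto u f) (c : ℝ) :
    AETendsto (fun n => c • u n) (c • f) := by
  filter_upwards [hu, AEEqFun.coeFn_smul c f, ae_all_iff.2 fun n => AEEqFun.coeFn_smul c (u n)]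
    with x h1 h3 h4
  simpa only [h3, h4, Pi.smul_apply] using h1.const_smul c

theorem AETendsto.comp {u : ℕ → M →ₘ[m] ℝ} {f : M →ₘ[m] ℝ} (hu : AETendsto u f) {φ : ℕ → ℕ}
    (hφ : Tendsto φ atTop atTop) : AETendsto (fun n => u (φ n)) f :=
  hu.mono fun _ hx => hx.comp hφ

/-- Convex combinations of the tails of an almost everywhere convergent sequence converge to the
same limit. -/
theorem AETendsto.of_mem_convexHull {u v : ℕ → M →ₘ[m] ℝ} {f : M →ₘ[m] ℝ} (hu : AETendsto u f)
    (hv : ∀ n, v n ∈ convexHull ℝ (u '' Set.Ici n)) : AETendsto v f := by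
  have h : ∀ n, ∀ᵐ x ∂m, v n x ∈ convexHull ℝ ((fun k => u k x) '' Set.Ici n) := by
    intro n
    refine convexHull_min (t := {w : M →ₘ[m] ℝ |
      ∀ᵐ x ∂m, w x ∈ convexHull ℝ ((fun k => u k x) '' Set.Ici n)}) ?_ ?_ (hv n)
    · rintro _ ⟨k, hk, rfl⟩
      change ∀ᵐ x ∂m, _
      exact Eventually.of_forall fun x =>
        subset_convexHull ℝ _ (Set.mem_image_of_mem (fun k => u k x) hk)
    · intro w hw w' hw' s t hs ht hst
      change ∀ᵐ x ∂m, _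
      filter_upwards [hw, hw', AEEqFun.coeFn_add (s • w) (t • w'), AEEqFun.coeFn_smul s w,
        AEEqFun.coeFn_smul t w'] with x h1 h2 h3 h4 h5
      rw [h3, Pi.add_apply, h4, h5]
      exact convex_convexHull ℝ _ h1 h2 hs ht hst
  filter_upwards [hu, ae_all_iff.2 h] with x h1 h2
  rw [Metric.tendsto_atTop] at h1 ⊢
  intro ε hε
  obtain ⟨N, hN⟩ := h1 ε hε
  refine ⟨N, fun n hn => ?_⟩
  refine convexHull_min (t := Metric.ball (f x) ε) ?_ (convex_ball _ _) (h2 n)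
  rintro _ ⟨k, hk, rfl⟩
  exact hN k (hn.trans hk)

end AETendsto

namespace LpFunctional

variable {M : Type*} [MeasurableSpace M] {m : Measure M} {p : ℝ≥0∞} [Fact (1 ≤ p)]

/-- The set of all strong limits of `d_F f_n`, where `f_n ∈ D(F)` converges to `f`
almost everywhere. -/
def relaxedDifferentials (F : LpFunctional m p) (f : M →ₘ[m] ℝ) : Set F.GenModule :=
  {ω | ∃ u : ℕ → F.dom, AETendsto (fun n => (u n : M →ₘ[m] ℝ)) f ∧
    Tendsto (fun n => F.d (u n)) atTop (𝓝 ω)}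

variable {F : LpFunctional m p} {f h : M →ₘ[m] ℝ} {ω η : F.GenModule}

theorem d_mem_relaxedDifferentials (f : F.dom) : F.d f ∈ F.relaxedDifferentials f :=
  ⟨fun _ => f, AETendsto.const _, tendsto_const_nhds⟩

theorem add_mem_relaxedDifferentials (hω : ω ∈ F.relaxedDifferentials f)
    (hη : η ∈ F.relaxedDifferentials h) : ω + η ∈ F.relaxedDifferentials (f + h) := by
  obtain ⟨u, hu, hu'⟩ := hω
  obtain ⟨v, hv, hv'⟩ := hη
  refine ⟨fun n => u n + v n, hu.add hv, ?_⟩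
  simpa only [map_add] using hu'.add hv'

theorem smul_mem_relaxedDifferentials (c : ℝ) (hω : ω ∈ F.relaxedDifferentials f) :
    c • ω ∈ F.relaxedDifferentials (c • f) := by
  obtain ⟨u, hu, hu'⟩ := hω
  refine ⟨fun n => c • u n, hu.const_smul c, ?_⟩
  simpa only [map_smul] using hu'.const_smul c

theorem smul_mem_limitsAtZero (c : ℝ) (hω : ω ∈ F.limitsAtZero) : c • ω ∈ F.limitsAtZero := by
  have h : c • ω ∈ F.relaxedDifferentials (c • 0) := smul_mem_relaxedDifferentials c hω
  rwa [smul_zero] at h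

theorem add_mem_limitsAtZero (hω : ω ∈ F.limitsAtZero) (hη : η ∈ F.limitsAtZero) :
    ω + η ∈ F.limitsAtZero := by
  have h : ω + η ∈ F.relaxedDifferentials (0 + 0) := add_mem_relaxedDifferentials hω hη
  rwa [add_zero] at h

theorem zero_mem_limitsAtZero (F : LpFunctional m p) : (0 : F.GenModule) ∈ F.limitsAtZero := by
  have h : F.d 0 ∈ F.relaxedDifferentials ((0 : F.dom) : M →ₘ[m] ℝ) :=
    d_mem_relaxedDifferentials 0
  rwa [map_zero, ZeroMemClass.coe_zero] at h

theorem sub_mem_limitsAtZero (hω : ω ∈ F.relaxedDifferentials f)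
    (hη : η ∈ F.relaxedDifferentials f) : ω - η ∈ F.limitsAtZero := by
  have h := add_mem_relaxedDifferentials hω (smul_mem_relaxedDifferentials (-1) hη)
  rwa [neg_smul, one_smul, neg_smul, one_smul, ← sub_eq_add_neg, ← sub_eq_add_neg, sub_self] at h

/-- Weak limits of differentials are relaxed differentials, by Mazur's lemma. -/
theorem mem_relaxedDifferentials_of_weakTendsto {u : ℕ → F.dom}
    (hu : AETendsto (fun n => (u n : M →ₘ[m] ℝ)) f) (hω : WeakTendsto (fun n => F.d (u n)) ω) :
    ω ∈ F.relaxedDifferentials f := by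
  have hex : ∀ n : ℕ, ∃ v ∈ convexHull ℝ (u '' Set.Ici n),
      dist (F.d v) ω < 1 / ((n : ℝ) + 1) := by
    intro n
    have hconv : Convex ℝ (F.d '' convexHull ℝ (u '' Set.Ici n)) :=
      (convex_convexHull ℝ _).linear_image F.d
    have hmem := hω.mem_of_isClosed_of_convex isClosed_closure hconv.closure
      ((eventually_ge_atTop n).mono fun k hk =>
        subset_closure ⟨u k, subset_convexHull ℝ _ ⟨k, hk, rfl⟩, rfl⟩)
    obtain ⟨_, ⟨v, hv, rfl⟩, hd⟩ :=
      Metric.mem_closure_iff.1 hmem _ (Nat.one_div_pos_of_nat (α := ℝ) (n := n))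
    exact ⟨v, hv, by rwa [dist_comm]⟩
  choose v hv hvω using hex
  refine ⟨v, hu.of_mem_convexHull fun n => ?_, ?_⟩
  · have h : (v n : M →ₘ[m] ℝ) ∈ F.dom.subtype '' convexHull ℝ (u '' Set.Ici n) :=
      ⟨v n, hv n, rfl⟩
    rw [F.dom.subtype.image_convexHull, Set.image_image] at h
    exact h
  · rw [tendsto_iff_dist_tendsto_zero]
    exact squeeze_zero (fun _ => dist_nonneg) (fun n => (hvω n).le)
      tendsto_one_div_add_atTop_nhds_zero_nat

/-- The pointwise norm is weakly lower semicontinuous, since `{(w, k) | |w| ≤ k}` is closed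
and convex. -/
theorem pnorm_le_of_weakTendsto {w : ℕ → F.GenModule} {G : Lp ℝ p m} (hω : WeakTendsto w ω)
    (hG : WeakTendsto (fun n => F.pnorm (w n)) G) : F.pnorm ω ≤ G := by
  refine (hω.prodMk hG).mem_of_isClosed_of_convex
    (C := {q : F.GenModule × Lp ℝ p m | F.pnorm q.1 ≤ q.2})
    (isClosed_le (F.continuous_pnorm.comp continuous_fst) continuous_snd) ?_
    (Eventually.of_forall fun n => le_refl (F.pnorm (w n)))
  rintro ⟨v, k⟩ hv ⟨v', k'⟩ hv' s t hs ht -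
  change F.pnorm (s • v + t • v') ≤ s • k + t • k'
  refine (F.pnorm_add_le _ _).trans ?_
  rw [pnorm_smul, pnorm_smul, abs_of_nonneg hs, abs_of_nonneg ht]
  exact add_le_add (smul_le_smul_of_nonneg_left hv hs) (smul_le_smul_of_nonneg_left hv' ht)

/-- The relaxed energy is finite exactly at the functions that have a relaxed differential. -/
theorem relaxedEnergy_lt_top_iff (hp : p ≠ ∞) (hF : F.WeaklyReflexive) :
    F.relaxedEnergy f < ∞ ↔ (F.relaxedDifferentials f).Nonempty := by
  have hp0 : p ≠ 0 := (zero_lt_one.trans_le (Fact.out : 1 ≤ p)).ne'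
  have hq : 0 < p.toReal := ENNReal.toReal_pos hp0 hp
  simp only [relaxedEnergy, iInf_lt_iff, ← Lp.enorm_rpow_eq_lintegral hp0 hp]
  constructor
  · rintro ⟨u, hu, hlt⟩
    obtain ⟨c, hc, hctop⟩ := exists_between hlt
    obtain ⟨φ, hφ, hφc⟩ := extraction_of_frequently_atTop
      (frequently_lt_of_liminf_lt (by isBoundedDefault) hc)
    obtain ⟨ψ, ω, hψ, hω⟩ := hF (fun n => u (φ n)) f (hu.comp hφ.tendsto_atTop)
      ⟨(c ^ p.toReal⁻¹).toReal, fun n => by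
        rw [norm_d, ← toReal_enorm]
        exact ENNReal.toReal_mono (ENNReal.rpow_ne_top_of_nonneg (inv_nonneg.2 hq.le) hctop.ne)
          ((ENNReal.le_rpow_inv_iff hq).2 (hφc n).le)⟩
    exact ⟨ω, mem_relaxedDifferentials_of_weakTendsto
      (hu.comp (hφ.comp hψ).tendsto_atTop) hω⟩
  · rintro ⟨ω, u, hu, hω⟩
    refine ⟨u, hu, ?_⟩
    have h : Tendsto (fun n => ‖F.g (u n)‖ₑ ^ p.toReal) atTop (𝓝 (‖ω‖ₑ ^ p.toReal)) := by
      have h1 := (ENNReal.continuous_rpow_const (y := p.toReal)).tendsto _ |>.comp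
        ((continuous_enorm.tendsto ω).comp hω)
      refine h1.congr fun n => ?_
      simp only [Function.comp_apply, ← ofReal_norm, norm_d]
    rw [h.liminf_eq]
    exact ENNReal.rpow_lt_top_of_nonneg hq.le enorm_ne_top

theorem mem_lowerBoundsAt_iff (hF : F.WeaklyReflexive) {G : Lp ℝ p m} :
    G ∈ F.lowerBoundsAt f ↔ ∀ ω ∈ F.relaxedDifferentials f, G ≤ F.pnorm ω := by
  constructor
  · rintro hG ω ⟨u, hu, hω⟩
    refine hG u _ hu (weakTendsto_of_tendsto ?_)
    simpa only [Function.comp_def, pnorm_d] using (F.continuous_pnorm.tendsto ω).comp hω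
  · intro hG u G' hu hG'
    obtain ⟨C, hC⟩ := hG'.exists_norm_le
    obtain ⟨φ, ω, hφ, hω⟩ := hF u f hu ⟨C, fun n => by rw [norm_d]; exact hC n⟩
    refine (hG ω (mem_relaxedDifferentials_of_weakTendsto (hu.comp hφ.tendsto_atTop) hω)).trans
      (pnorm_le_of_weakTendsto hω ?_)
    simpa only [pnorm_d] using hG'.comp hφ.tendsto_atTop

/-- A lower bound of `|v + q w|` for all constants `q` is also one of `|v + a w|` for bounded
functions `a`: almost everywhere, `a x` can be approximated by rational constants. -/
theorem le_pnorm_add_linftyMul {G : Lp ℝ p m} {v w : F.GenModule}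
    (hG : ∀ q : ℝ, G ≤ F.pnorm (v + q • w)) (a : Lp ℝ ∞ m) :
    G ≤ F.pnorm (v + F.linftyMul a w) := by
  have h : ∀ q : ℚ, ∀ᵐ x ∂m,
      G x ≤ F.pnorm (v + F.linftyMul a w) x + |(q : ℝ) - a x| * F.pnorm w x := by
    intro q
    have h1 : F.linftyMul (linftyIndicator m .univ (q : ℝ) - a) w =
        (v + (q : ℝ) • w) - (v + F.linftyMul a w) := by
      rw [add_sub_add_left_eq_sub, eq_sub_iff_add_eq, ← linftyMul_add, sub_add_cancel,
        linftyMul_univ]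
    have h2 := (hG q).trans (F.pnorm_le_add_sub _ (v + F.linftyMul a w))
    rw [← h1] at h2
    filter_upwards [(Lp.coeFn_le _ _).2 h2, Lp.coeFn_add (F.pnorm (v + F.linftyMul a w))
      (F.pnorm (F.linftyMul (linftyIndicator m .univ (q : ℝ) - a) w)),
      F.coeFn_pnorm_linftyMul (linftyIndicator m .univ (q : ℝ) - a) w,
      Lp.coeFn_sub (linftyIndicator m .univ (q : ℝ)) a,
      coeFn_linftyIndicator (m := m) .univ (q : ℝ)] with x h3 h4 h5 h6 h7
    rw [h4, Pi.add_apply, h5, h6, Pi.sub_apply, h7] at h3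
    simpa using h3
  rw [← Lp.coeFn_le]
  filter_upwards [ae_all_iff.2 h] with x hx
  have hcl : IsClosed {t : ℝ | G x ≤ F.pnorm (v + F.linftyMul a w) x +
      |t - a x| * F.pnorm w x} := isClosed_le (by fun_prop) (by fun_prop)
  have h0 := (Rat.denseRange_cast (𝕜 := ℝ)).induction_on (p := fun t : ℝ =>
    G x ≤ F.pnorm (v + F.linftyMul a w) x + |t - a x| * F.pnorm w x) (a x) hcl hx
  simpa using h0

/-- A lower bound of `|v + η|` for `η` in the linear space `G₀` is also one for `η` in the
submodule `M₀` it generates. -/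
theorem le_pnorm_add_of_mem_zeroModule {G : Lp ℝ p m} {v : F.GenModule}
    (hG : ∀ η ∈ F.limitsAtZero, G ≤ F.pnorm (v + η)) :
    ∀ η ∈ F.zeroModule, G ≤ F.pnorm (v + η) := by
  -- Universal quantification over `v` lets the summands of `η` be added one at a time.
  suffices h : ∀ η ∈ Submodule.span ℝ
      {w | ∃ a : Lp ℝ ∞ m, ∃ v ∈ F.limitsAtZero, w = F.linftyMul a v}, ∀ v : F.GenModule,
      (∀ η ∈ F.limitsAtZero, G ≤ F.pnorm (v + η)) →
        ∀ η' ∈ F.limitsAtZero, G ≤ F.pnorm (v + η + η') by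
    intro η hη
    refine closure_minimal (t := {η | G ≤ F.pnorm (v + η)}) (fun η hη => ?_)
      (isClosed_le continuous_const (F.continuous_pnorm.comp (continuous_const_add v))) hη
    simpa using h η hη v hG 0 F.zero_mem_limitsAtZero
  intro η hη
  rw [← Submodule.mem_toAddSubmonoid, Submodule.span_eq_closure] at hη
  induction hη using AddSubmonoid.closure_induction with
  | mem η hη =>
    obtain ⟨c, -, _, ⟨a, w, hw, rfl⟩, rfl⟩ := hη
    intro v hv η' hη'
    change G ≤ F.pnorm (v + c • F.linftyMul a w + η')
    rw [← map_smul, add_right_comm]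
    refine le_pnorm_add_linftyMul (fun q => ?_) a
    rw [add_assoc]
    exact hv _ (add_mem_limitsAtZero hη' (smul_mem_limitsAtZero q (smul_mem_limitsAtZero c hw)))
  | zero =>
    intro v hv η' hη'
    simpa using hv η' hη'
  | add η₁ η₂ _ _ h₁ h₂ =>
    intro v hv η' hη'
    rw [← add_assoc]
    exact h₂ _ (h₁ v hv) η' hη'

/-! ### Submodules generated by a set -/

theorem linftyMul_mem_moduleSpan {S : Set F.GenModule} {v : F.GenModule} (hv : v ∈ S)
    (a : Lp ℝ ∞ m) : F.linftyMul a v ∈ F.moduleSpan S :=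
  subset_closure (Submodule.subset_span ⟨a, v, hv, rfl⟩)

theorem subset_moduleSpan (S : Set F.GenModule) : S ⊆ F.moduleSpan S := by
  intro v hv
  have h := linftyMul_mem_moduleSpan hv (linftyIndicator m .univ 1)
  rwa [linftyMul_univ, one_smul] at h

/-- A continuous linear map sends a generated submodule into a closed linear subspace, as soon as
it does so with the multiples of the generators. -/
theorem map_mem_of_mem_moduleSpan {E : Type*} [NormedAddCommGroup E] [NormedSpace ℝ E]
    {S : Set F.GenModule} (T : F.GenModule →L[ℝ] E) {N : Submodule ℝ E}
    (hN : IsClosed (N : Set E)) (h : ∀ a : Lp ℝ ∞ m, ∀ v ∈ S, T (F.linftyMul a v) ∈ N)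
    {w : F.GenModule} (hw : w ∈ F.moduleSpan S) : T w ∈ N := by
  refine Submodule.topologicalClosure_minimal (t := N.comap (T : F.GenModule →ₗ[ℝ] E)) _
    (Submodule.span_le.2 ?_) (hN.preimage T.continuous) hw
  rintro _ ⟨a, v, hv, rfl⟩
  exact h a v hv

theorem linftyMul_mem_of_mem_moduleSpan {S : Set F.GenModule} {w : F.GenModule}
    (hw : w ∈ F.moduleSpan S) (a : Lp ℝ ∞ m) : F.linftyMul a w ∈ F.moduleSpan S :=
  map_mem_of_mem_moduleSpan (F.linftyMul a) (Submodule.isClosed_topologicalClosure _)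
    (fun b v hv => by
      rw [← linftyMul_mul]
      exact linftyMul_mem_moduleSpan hv _) hw

/-- If `s` takes the value `f` on `A`, then `χ_A s = χ_A d f`. -/
theorem linftyIndicator_mul_coe {A : Set M} (hA : MeasurableSet A) {s : F.Pfm} {f : F.dom}
    (hs : ∀ x ∈ A, s.1 x = f) :
    F.linftyMul (linftyIndicator m hA 1) s = F.linftyMul (linftyIndicator m hA 1) (F.d f) := by
  set t : F.Pfm := F.stepMul _ (isStepReal_indicator hA) 1 (Eventually.of_forall fun x => by
    by_cases hx : x ∈ A <;> simp [hx]) s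
  have hb := isStepReal_indicator hA
  have hae := coeFn_linftyIndicator (m := m) hA 1
  have h1 : F.linftyMul (linftyIndicator m hA 1) s = t :=
    F.linftyMul_coe_of_ae_eq hb hae fun x => rfl
  have h2 : F.linftyMul (linftyIndicator m hA 1) (F.const f : F.Pfm) = t := by
    refine F.linftyMul_coe_of_ae_eq hb hae fun x => ?_
    change A.indicator (fun _ => (1 : ℝ)) x • s.1 x = A.indicator (fun _ => (1 : ℝ)) x • f
    by_cases hx : x ∈ A
    · rw [hs x hx]
    · simp [hx]
  exact h1.trans h2.symm

/-- The generated module is the closure of the span of the multiples of differentials, because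
every element `∑ χ_{A_i} f_i` of `Pfm` is the limit of its finite partial sums. -/
theorem mem_moduleSpan_range_d (hp : p ≠ ∞) (v : F.GenModule) :
    v ∈ F.moduleSpan (Set.range F.d) := by
  induction v using UniformSpace.Completion.induction_on with
  | hp => exact Submodule.isClosed_topologicalClosure _
  | ih s =>
    obtain ⟨k, f, hk, hs⟩ := s.2.1
    have hA : ∀ n, MeasurableSet {x | n ≤ k x} := fun n => hk measurableSet_Ici
    set r : ℕ → F.GenModule := fun n => F.linftyMul (linftyIndicator m (hA n) 1) s with hr
    have hsum : ∀ n, (s : F.GenModule) - r n ∈ F.moduleSpan (Set.range F.d) := by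
      intro n
      induction n with
      | zero =>
        have h : {x | 0 ≤ k x} = Set.univ := by simp
        have h0 : r 0 = s := by
          simp only [hr, h]
          rw [linftyMul_univ, one_smul]
        rw [h0, sub_self]
        exact zero_mem _
      | succ n ih =>
        have hB : MeasurableSet {x | k x = n} := hk (measurableSet_singleton n)
        have h1 : linftyIndicator m (hA n) 1 =
            linftyIndicator m (hA (n + 1)) 1 + linftyIndicator m hB 1 := by
          apply Lp.ext
          filter_upwards [coeFn_linftyIndicator (m := m) (hA n) 1,
            coeFn_linftyIndicator (m := m) (hA (n + 1)) 1, coeFn_linftyIndicator (m := m) hB 1,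
            Lp.coeFn_add (linftyIndicator m (hA (n + 1)) 1) (linftyIndicator m hB 1)]
            with x h1 h2 h3 h4
          rw [h4, Pi.add_apply, h1, h2, h3]
          simp only [Set.indicator_apply, Set.mem_ofPred_eq]
          split_ifs <;> first | omega | norm_num
        have h2 : r n = r (n + 1) + F.linftyMul (linftyIndicator m hB 1) (F.d (f n)) := by
          rw [← linftyIndicator_mul_coe hB (s := s) fun x (hx : k x = n) => by
            rw [hs, Function.comp_apply, hx]]
          simp only [hr]
          rw [h1, linftyMul_add]
        have h3 : (s : F.GenModule) - r (n + 1) =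
            s - r n + F.linftyMul (linftyIndicator m hB 1) (F.d (f n)) := by
          rw [h2]
          abel
        rw [h3]
        exact add_mem ih (linftyMul_mem_moduleSpan (Set.mem_range_self _) _)
    have hrx : ∀ᵐ x ∂m, ∀ n, F.pnorm (r n) x =
        {x | n ≤ k x}.indicator (fun x => F.pnorm (s : F.GenModule) x) x :=
      ae_all_iff.2 fun n => F.coeFn_pnorm_linftyIndicator (hA n) s
    have hanti : Antitone fun n => F.pnorm (r n) := by
      intro i j hij
      rw [← Lp.coeFn_le]
      filter_upwards [hrx, (Lp.coeFn_nonneg _).2 (F.pnorm_nonneg (s : F.GenModule))] with x h1 h2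
      rw [h1, h1]
      exact Set.indicator_le_indicator_of_subset (fun x hx => hij.trans hx) (fun _ => h2) x
    -- The pointwise norms of the remainders decrease to `0`, hence have `0` in their closure.
    obtain ⟨G, hG, hGlb⟩ := Lp.exists_isGLB_mem_closure hp (S := Set.range fun n => F.pnorm (r n))
      (Set.range_nonempty _) (by rintro _ ⟨n, rfl⟩; exact F.pnorm_nonneg _) (by
        rintro _ ⟨i, rfl⟩ _ ⟨j, rfl⟩
        rcases le_total i j with h | h
        · exact ⟨j, (inf_eq_right.2 (hanti h)).symm⟩
        · exact ⟨i, (inf_eq_left.2 (hanti h)).symm⟩)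
    have hG0 : G ≤ 0 := by
      rw [← Lp.coeFn_le]
      filter_upwards [hrx,
        ae_all_iff.2 fun n => (Lp.coeFn_le _ _).2 (hGlb.1 (Set.mem_range_self n)),
        Lp.coeFn_zero ℝ p m] with x h1 h2 h3
      refine (h2 (k x + 1)).trans ?_
      rw [h1, h3]
      simp
    have hG1 : G = 0 :=
      le_antisymm hG0 (hGlb.2 (by rintro _ ⟨n, rfl⟩; exact F.pnorm_nonneg _))
    refine (Submodule.isClosed_topologicalClosure _).closure_subset
      (Metric.mem_closure_iff.2 fun ε hε => ?_)
    obtain ⟨_, ⟨n, rfl⟩, hn⟩ := Metric.mem_closure_iff.1 hG ε hε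
    refine ⟨_, hsum n, ?_⟩
    rw [hG1, dist_zero_left, norm_pnorm] at hn
    rwa [dist_eq_norm, sub_sub_cancel]

end LpFunctional

namespace LpFunctional

variable {M : Type*} [MeasurableSpace M] {m : Measure M} {p : ℝ≥0∞} [Fact (1 ≤ p)]

/-! ### The lower relaxation -/

section Relaxation

variable {F : LpFunctional m p} {f h : M →ₘ[m] ℝ} {ω : F.GenModule}

/-- Since the relaxed differentials of `f` form a coset of `G₀`, the lower bounds that define the
relaxation at `f` are those of the pointwise norms of a coset of `M₀`. -/
theorem lowerBoundsAt_eq_lowerBounds (hF : F.WeaklyReflexive)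
    (hω : ω ∈ F.relaxedDifferentials f) :
    F.lowerBoundsAt f = lowerBounds (Set.range fun η : F.zeroModule => F.pnorm (ω + η)) := by
  ext G
  rw [mem_lowerBoundsAt_iff hF]
  constructor
  · rintro hG _ ⟨η, rfl⟩
    refine le_pnorm_add_of_mem_zeroModule (fun η hη => hG _ ?_) η η.2
    have h := add_mem_relaxedDifferentials hω (show η ∈ F.relaxedDifferentials 0 from hη)
    rwa [add_zero] at h
  · intro hG ω' hω'
    have h := hG ⟨⟨ω' - ω, subset_moduleSpan _ (sub_mem_limitsAtZero hω' hω)⟩, rfl⟩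
    simpa using h

/-- The pointwise norm of a class in `M / M₀` exists as a limit of pointwise norms of
representatives: these are stable under `⊓` by gluing. -/
theorem exists_isGLB_pnorm_add (hp : p ≠ ∞) (v : F.GenModule) :
    ∃ G ∈ closure (Set.range fun η : F.zeroModule => F.pnorm (v + η)),
      IsGLB (Set.range fun η : F.zeroModule => F.pnorm (v + η)) G := by
  refine Lp.exists_isGLB_mem_closure hp (Set.range_nonempty _) ?_ ?_
  · rintro _ ⟨η, rfl⟩
    exact F.pnorm_nonneg _
  · rintro _ ⟨η, rfl⟩ _ ⟨η', rfl⟩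
    obtain ⟨a, b, hab, h⟩ := F.exists_pnorm_eq_inf (v + η) (v + η')
    refine ⟨⟨F.linftyMul a η + F.linftyMul b η', add_mem
      (linftyMul_mem_of_mem_moduleSpan η.2 a) (linftyMul_mem_of_mem_moduleSpan η'.2 b)⟩, ?_⟩
    have hv : F.linftyMul a v + F.linftyMul b v = v := by
      rw [← linftyMul_add, hab, linftyMul_univ, one_smul]
    dsimp only
    rw [← h, map_add, map_add, add_add_add_comm, hv]

theorem exists_isGreatest_lowerBoundsAt (hp : p ≠ ∞) (hF : F.WeaklyReflexive)
    (hf : (F.relaxedDifferentials f).Nonempty) : ∃ G, IsGreatest (F.lowerBoundsAt f) G := by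
  obtain ⟨ω, hω⟩ := hf
  obtain ⟨G, -, hG⟩ := exists_isGLB_pnorm_add hp ω
  rw [lowerBoundsAt_eq_lowerBounds hF hω]
  exact ⟨G, hG⟩

theorem isGreatest_add_le (hF : F.WeaklyReflexive) {G H K : Lp ℝ p m}
    (hG : IsGreatest (F.lowerBoundsAt f) G) (hH : IsGreatest (F.lowerBoundsAt h) H)
    (hK : IsGreatest (F.lowerBoundsAt (f + h)) K) : K ≤ G + H := by
  rw [← sub_le_iff_le_add']
  refine hH.2 ((mem_lowerBoundsAt_iff hF).2 fun η hη => ?_)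
  rw [sub_le_comm]
  refine hG.2 ((mem_lowerBoundsAt_iff hF).2 fun ω hω => ?_)
  rw [sub_le_iff_le_add]
  exact ((mem_lowerBoundsAt_iff hF).1 hK.1 _ (add_mem_relaxedDifferentials hω hη)).trans
    (F.pnorm_add_le ω η)

theorem isGreatest_smul_le (hF : F.WeaklyReflexive) {G K : Lp ℝ p m} {c : ℝ}
    (hf : (F.relaxedDifferentials f).Nonempty) (hG : IsGreatest (F.lowerBoundsAt f) G)
    (hK : IsGreatest (F.lowerBoundsAt (c • f)) K) : K ≤ |c| • G := by
  have hle : ∀ ω ∈ F.relaxedDifferentials f, K ≤ |c| • F.pnorm ω := fun ω hω => by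
    rw [← pnorm_smul]
    exact (mem_lowerBoundsAt_iff hF).1 hK.1 _ (smul_mem_relaxedDifferentials c hω)
  rcases eq_or_ne c 0 with rfl | hc
  · obtain ⟨ω, hω⟩ := hf
    simpa using hle ω hω
  · have hc' : 0 < |c| := abs_pos.2 hc
    rw [← inv_smul_le_iff_of_pos hc']
    refine hG.2 ((mem_lowerBoundsAt_iff hF).2 fun ω hω => ?_)
    rw [inv_smul_le_iff_of_pos hc']
    exact hle ω hω

/-- The lower relaxation of a functional that generates a weakly reflexive module. -/
noncomputable def relaxation (F : LpFunctional m p) (hp : p ≠ ∞) (hF : F.WeaklyReflexive) :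
    LpFunctional m p where
  dom :=
    { carrier := {f | (F.relaxedDifferentials f).Nonempty}
      zero_mem' := ⟨0, F.zero_mem_limitsAtZero⟩
      add_mem' := fun ⟨ω, hω⟩ ⟨η, hη⟩ => ⟨ω + η, add_mem_relaxedDifferentials hω hη⟩
      smul_mem' := fun c _ ⟨ω, hω⟩ => ⟨c • ω, smul_mem_relaxedDifferentials c hω⟩ }
  g f := (exists_isGreatest_lowerBoundsAt hp hF f.2).choose
  g_nonneg f := (exists_isGreatest_lowerBoundsAt hp hF f.2).choose_spec.2
    ((mem_lowerBoundsAt_iff hF).2 fun ω _ => F.pnorm_nonneg ω)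
  g_add_le f h := isGreatest_add_le hF (exists_isGreatest_lowerBoundsAt hp hF f.2).choose_spec
    (exists_isGreatest_lowerBoundsAt hp hF h.2).choose_spec
    (exists_isGreatest_lowerBoundsAt hp hF (f + h).2).choose_spec
  g_smul c f := by
    have hf := (exists_isGreatest_lowerBoundsAt hp hF f.2).choose_spec
    have hcf := (exists_isGreatest_lowerBoundsAt hp hF (c • f).2).choose_spec
    refine le_antisymm (isGreatest_smul_le hF f.2 hf hcf) ?_
    rcases eq_or_ne c 0 with rfl | hc
    · rw [abs_zero, zero_smul]
      exact hcf.2 ((mem_lowerBoundsAt_iff hF).2 fun ω _ => F.pnorm_nonneg ω)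
    · rw [← le_inv_smul_iff_of_pos (abs_pos.2 hc), ← abs_inv]
      refine isGreatest_smul_le hF (c • f).2 hcf ?_
      rw [Submodule.coe_smul, inv_smul_smul₀ hc]
      exact hf

theorem isLowerRelaxation_relaxation (hp : p ≠ ∞) (hF : F.WeaklyReflexive) :
    F.IsLowerRelaxation (F.relaxation hp hF) where
  mem_dom _ := (relaxedEnergy_lt_top_iff hp hF).symm
  isGreatest f := (exists_isGreatest_lowerBoundsAt hp hF f.2).choose_spec

theorem dom_le_dom_relaxation (hp : p ≠ ∞) (hF : F.WeaklyReflexive) :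
    F.dom ≤ (F.relaxation hp hF).dom :=
  fun f hf => ⟨F.d ⟨f, hf⟩, d_mem_relaxedDifferentials ⟨f, hf⟩⟩

end Relaxation

/-! ### Comparison of the modules of two functionals -/

section Comparison

variable {F F' : LpFunctional m p} (hD : F.dom ≤ F'.dom)
  (hle : ∀ f, F'.g (Submodule.inclusion hD f) ≤ F.g f)

/-- If `F'` is defined and smaller than `F` on the domain of `F`, then `Pfm` for `F` is contained
in `Pfm` for `F'`. -/
noncomputable def pfmMap : F.Pfm →L[ℝ] F'.Pfm :=
  have hstep : ∀ s : F.Pfm, F'.IsStep fun x => Submodule.inclusion hD (s.1 x) := fun s => by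
    obtain ⟨k, f, hk, hs⟩ := s.2.1
    exact ⟨k, fun i => Submodule.inclusion hD (f i), hk, by rw [hs]; rfl⟩
  have hnorm : ∀ s : F.Pfm, ∀ᵐ x ∂m,
      ‖F'.ptNorm (fun x => Submodule.inclusion hD (s.1 x)) x‖ ≤ F.ptNorm s.1 x := fun s => by
    filter_upwards [(hstep s).ptNorm_nonneg, s.2.1.ae
      (P := fun f x => F'.g (Submodule.inclusion hD f) x ≤ F.g f x)
      fun f => (Lp.coeFn_le _ _).2 (hle f)] with x h1 h2
    rw [Real.norm_of_nonneg h1]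
    exact h2
  have hmem : ∀ s : F.Pfm, MemLp (F'.ptNorm fun x => Submodule.inclusion hD (s.1 x)) p m :=
    fun s => s.2.2.mono (hstep s).aestronglyMeasurable <| by
      filter_upwards [hnorm s] with x hx using hx.trans (le_abs_self _)
  LinearMap.mkContinuous
    { toFun := fun s => ⟨fun x => Submodule.inclusion hD (s.1 x), hstep s, hmem s⟩
      map_add' := fun _ _ => rfl
      map_smul' := fun _ _ => rfl }
    1 fun s => by
      refine Lp.norm_le_mul_norm_of_ae_le_mul ?_
      filter_upwards [hnorm s, F.coeFn_pfmNorm s, F'.coeFn_pfmNorm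
        ⟨fun x => Submodule.inclusion hD (s.1 x), hstep s, hmem s⟩] with x h1 h2 h3
      rw [one_mul, h2]
      exact (congrArg norm h3).le.trans (h1.trans (le_abs_self _))

/-- The map between the generated modules induced by `f ↦ f`. -/
noncomputable def moduleMap : F.GenModule →L[ℝ] F'.GenModule :=
  (pfmMap hD hle).completion

theorem moduleMap_coe (s : F.Pfm) : moduleMap hD hle s = (pfmMap hD hle s : F'.Pfm) :=
  ContinuousLinearMap.completion_apply_coe _ s

theorem moduleMap_d (f : F.dom) : moduleMap hD hle (F.d f) = F'.d (Submodule.inclusion hD f) :=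
  moduleMap_coe hD hle (F.const f)

theorem moduleMap_linftyMul (a : Lp ℝ ∞ m) (v : F.GenModule) :
    moduleMap hD hle (F.linftyMul a v) = F'.linftyMul a (moduleMap hD hle v) := by
  induction v using UniformSpace.Completion.induction_on with
  | hp => exact isClosed_eq (by fun_prop) (by fun_prop)
  | ih s =>
    have h1 := ((moduleMap hD hle).continuous.tendsto _).comp (F.tendsto_approxMul a s)
    rw [moduleMap_coe]
    refine tendsto_nhds_unique h1 ((F'.tendsto_approxMul a (pfmMap hD hle s)).congr fun n => ?_)
    rw [Function.comp_apply, moduleMap_coe]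
    rfl

theorem pnorm_moduleMap_le (v : F.GenModule) : F'.pnorm (moduleMap hD hle v) ≤ F.pnorm v := by
  induction v using UniformSpace.Completion.induction_on with
  | hp =>
    exact isClosed_le (F'.continuous_pnorm.comp (moduleMap hD hle).continuous) F.continuous_pnorm
  | ih s =>
    rw [moduleMap_coe, pnorm_coe, pnorm_coe, ← Lp.coeFn_le]
    filter_upwards [F.coeFn_pfmNorm s, F'.coeFn_pfmNorm (pfmMap hD hle s), s.2.1.ae
      (P := fun f x => F'.g (Submodule.inclusion hD f) x ≤ F.g f x)
      fun f => (Lp.coeFn_le _ _).2 (hle f)] with x h1 h2 h3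
    rw [h1, h2]
    exact h3

theorem moduleMap_mem_submoduleGeneratedBy (hp : p ≠ ∞) (v : F.GenModule) :
    moduleMap hD hle v ∈ F'.submoduleGeneratedBy F.dom := by
  refine map_mem_of_mem_moduleSpan (moduleMap hD hle) (Submodule.isClosed_topologicalClosure _) ?_
    (mem_moduleSpan_range_d hp v)
  rintro a _ ⟨f, rfl⟩
  rw [moduleMap_linftyMul, moduleMap_d]
  refine linftyMul_mem_moduleSpan ?_ a
  exact ⟨_, f.2, rfl⟩

end Comparison

/-! ### The isometry with the quotient module -/

section Quotient

variable {F F' : LpFunctional m p} (hD : F.dom ≤ F'.dom)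
  (hle : ∀ f, F'.g (Submodule.inclusion hD f) ≤ F.g f)
  (hglb : ∀ f : F.dom, IsGLB (Set.range fun ω : F.zeroModule => F.pnorm (F.d f + ω))
    (F'.g (Submodule.inclusion hD f)))

include hglb in
theorem moduleMap_eq_zero_of_mem_zeroModule {ω : F.GenModule} (hω : ω ∈ F.zeroModule) :
    moduleMap hD hle ω = 0 := by
  rw [← Submodule.mem_bot ℝ]
  refine map_mem_of_mem_moduleSpan (moduleMap hD hle) (by simp) ?_ hω
  intro a v hv
  obtain ⟨u, -, hlim⟩ := id hv
  suffices h : moduleMap hD hle v = 0 by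
    rw [moduleMap_linftyMul, h, map_zero]
    exact zero_mem _
  refine tendsto_nhds_unique (((moduleMap hD hle).continuous.tendsto _).comp hlim) ?_
  have h0 := (tendsto_iff_norm_sub_tendsto_zero.1 hlim)
  refine squeeze_zero_norm (fun n => ?_) h0
  rw [Function.comp_apply, moduleMap_d, norm_d, ← norm_pnorm, sub_eq_add_neg]
  exact Lp.norm_le_norm_of_nonneg_of_le (F'.g_nonneg _)
    ((hglb (u n)).1 ⟨⟨-v, neg_mem (subset_moduleSpan _ hv)⟩, rfl⟩)

include hglb in
/-- The pointwise norm of the image of `v` is that of the class of `v` in the quotient. For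
`v = ∑ χ_{A_i} f_i` this is local to the sets `A_i`, where it is the hypothesis on differentials;
the general case follows by density. -/
theorem isGLB_pnorm_moduleMap (v : F.GenModule) :
    IsGLB (Set.range fun ω : F.zeroModule => F.pnorm (v + ω)) (F'.pnorm (moduleMap hD hle v)) := by
  constructor
  · rintro _ ⟨ω, rfl⟩
    have h := pnorm_moduleMap_le hD hle (v + ω)
    rwa [map_add, moduleMap_eq_zero_of_mem_zeroModule hD hle hglb ω.2, add_zero] at h
  have hstep : ∀ (s : F.Pfm) (L : Lp ℝ p m),
      (∀ ω : F.zeroModule, L ≤ F.pnorm (s + ω)) → L ≤ F'.pnorm (moduleMap hD hle s) := by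
    intro s L hL
    obtain ⟨k, f, hk, hs⟩ := s.2.1
    have hA : ∀ i, MeasurableSet {x | k x = i} := fun i => hk (measurableSet_singleton i)
    have hi : ∀ i, ∀ᵐ x ∂m, k x = i → L x ≤ F'.g (Submodule.inclusion hD (f i)) x := by
      intro i
      have hbd : (linftyIndicator m (hA i) 1 • L : Lp ℝ p m) ≤
          F'.g (Submodule.inclusion hD (f i)) := by
        refine (hglb (f i)).2 ?_
        rintro _ ⟨ω, rfl⟩
        have hloc : F.linftyMul (linftyIndicator m (hA i) 1) (s + ω) =
            F.linftyMul (linftyIndicator m (hA i) 1) (F.d (f i) + ω) := by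
          rw [map_add, map_add, linftyIndicator_mul_coe (hA i) (s := s) (f := f i)
            fun x (hx : k x = i) => by rw [hs, Function.comp_apply, hx]]
        dsimp only
        rw [← Lp.coeFn_le]
        filter_upwards [F.pnorm_ae_eq_of_linftyIndicator_eq (hA i) hloc,
          (Lp.coeFn_le _ _).2 (hL ω), coeFn_linftyIndicator (m := m) (hA i) 1,
          Lp.coeFn_lpSMul (r := p) (linftyIndicator m (hA i) 1) L,
          (Lp.coeFn_nonneg _).2 (F.pnorm_nonneg (F.d (f i) + ω))] with x h1 h2 h3 h4 h5
        rw [h4, Pi.smul_apply', h3]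
        by_cases hx : k x = i
        · rw [Set.indicator_of_mem (show x ∈ {x | k x = i} from hx), one_smul, ← h1 hx]
          exact h2
        · rw [Set.indicator_of_notMem (show x ∉ {x | k x = i} from hx), zero_smul]
          exact h5
      filter_upwards [(Lp.coeFn_le _ _).2 hbd, coeFn_linftyIndicator (m := m) (hA i) 1,
        Lp.coeFn_lpSMul (r := p) (linftyIndicator m (hA i) 1) L] with x h1 h2 h3 hx
      rwa [h3, Pi.smul_apply', h2, Set.indicator_of_mem (show x ∈ {x | k x = i} from hx),
        one_smul] at h1
    rw [moduleMap_coe, pnorm_coe, ← Lp.coeFn_le]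
    filter_upwards [ae_all_iff.2 hi, F'.coeFn_pfmNorm (pfmMap hD hle s)] with x h1 h2
    rw [h2]
    refine (h1 _ rfl).trans_eq ?_
    change _ = F'.g (Submodule.inclusion hD (s.1 x)) x
    rw [hs]
    rfl
  intro L hL
  -- `L - |v - s|` is a lower bound for `s`, and it tends to `L` as `s` tends to `v`.
  have hle' : ∀ s : F.Pfm, L ≤ F'.pnorm (moduleMap hD hle s) + F.pnorm (v - s) := by
    intro s
    rw [← sub_le_iff_le_add]
    refine hstep s _ fun ω => ?_
    rw [sub_le_iff_le_add]
    refine (hL ⟨ω, rfl⟩).trans ((F.pnorm_le_add_sub _ (s + ω)).trans_eq ?_)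
    rw [add_sub_add_right_eq_sub]
  have hcl : IsClosed {w | L ≤ F'.pnorm (moduleMap hD hle w) + F.pnorm (v - w)} :=
    isClosed_le continuous_const ((F'.continuous_pnorm.comp (moduleMap hD hle).continuous).add
      (F.continuous_pnorm.comp (continuous_const.sub continuous_id)))
  have h := UniformSpace.Completion.induction_on
    (p := fun w => L ≤ F'.pnorm (moduleMap hD hle w) + F.pnorm (v - w)) v hcl hle'
  have h0 : F.pnorm (0 : F.GenModule) = 0 := by
    rw [← norm_eq_zero, norm_pnorm, norm_zero]
  rwa [sub_self, h0, add_zero] at h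

include hglb in
theorem isGLB_norm_moduleMap (hp : p ≠ ∞) (v : F.GenModule) :
    IsGLB (Set.range fun ω : F.zeroModule => ‖v + ω‖) ‖moduleMap hD hle v‖ := by
  obtain ⟨G, hG, hGlb⟩ := exists_isGLB_pnorm_add hp v
  obtain rfl := hGlb.unique (isGLB_pnorm_moduleMap hD hle hglb v)
  have h := Lp.isGLB_norm_image (by rintro _ ⟨ω, rfl⟩; exact F.pnorm_nonneg _) hGlb hG
  rw [← Set.range_comp] at h
  simpa only [Function.comp_def, norm_pnorm] using h

include hglb in
theorem norm_moduleMap (hp : p ≠ ∞) (v : F.GenModule) :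
    ‖moduleMap hD hle v‖ = ‖(Submodule.Quotient.mk v : F.GenModule ⧸ F.zeroModule)‖ := by
  have h := isGLB_norm_moduleMap hD hle hglb hp v
  refine le_antisymm (le_of_forall_pos_le_add fun ε hε => ?_) (h.2 ?_)
  · obtain ⟨w, hw, hlt⟩ := Submodule.Quotient.norm_mk_lt
      (Submodule.Quotient.mk v : F.GenModule ⧸ F.zeroModule) hε
    have h1 := h.1 ⟨⟨w - v, (Submodule.Quotient.eq _).1 hw⟩, rfl⟩
    simp only [add_sub_cancel] at h1
    exact h1.trans hlt.le
  · rintro _ ⟨ω, rfl⟩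
    have h1 : (Submodule.Quotient.mk v : F.GenModule ⧸ F.zeroModule) =
        Submodule.Quotient.mk (v + ω) := (Submodule.Quotient.eq _).2 (by simp)
    rw [h1]
    exact Submodule.Quotient.norm_mk_le _ _

/-- The isometric embedding of the quotient module `M_F / M₀` into the module of `F'`. -/
noncomputable def quotientMap (hp : p ≠ ∞) : F.GenModule ⧸ F.zeroModule →ₗᵢ[ℝ] F'.GenModule where
  toLinearMap := F.zeroModule.liftQ (moduleMap hD hle : F.GenModule →ₗ[ℝ] F'.GenModule)
    fun _ hω => moduleMap_eq_zero_of_mem_zeroModule hD hle hglb hω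
  norm_map' := by
    intro x
    obtain ⟨v, rfl⟩ := Submodule.Quotient.mk_surjective _ x
    exact norm_moduleMap hD hle hglb hp v

/-- The range of `M_F / M₀`, closed by completeness, is the submodule generated by `D(F)`. -/
theorem range_quotientMap (hp : p ≠ ∞) :
    LinearMap.range (quotientMap hD hle hglb hp).toLinearMap = F'.submoduleGeneratedBy F.dom := by
  apply le_antisymm
  · rintro _ ⟨x, rfl⟩
    obtain ⟨v, rfl⟩ := Submodule.Quotient.mk_surjective _ x
    exact moduleMap_mem_submoduleGeneratedBy hD hle hp v
  · intro w hw
    refine map_mem_of_mem_moduleSpan (ContinuousLinearMap.id ℝ F'.GenModule)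
      (quotientMap hD hle hglb hp).isometry.isClosedEmbedding.isClosed_range ?_ hw
    rintro a _ ⟨f, hf, rfl⟩
    refine ⟨Submodule.Quotient.mk (F.linftyMul a (F.d ⟨f, hf⟩)), ?_⟩
    change moduleMap hD hle _ = _
    rw [moduleMap_linftyMul, moduleMap_d]
    rfl

/-- The isometry between the submodule generated by `D(F)` and the quotient module. -/
noncomputable def quotientEquiv (hp : p ≠ ∞) :
    F'.submoduleGeneratedBy F.dom ≃ₗᵢ[ℝ] F.GenModule ⧸ F.zeroModule :=
  (LinearIsometryEquiv.ofEq _ _ (range_quotientMap hD hle hglb hp).symm).trans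
    (quotientMap hD hle hglb hp).equivRange.symm

theorem quotientEquiv_eq_mk_iff (hp : p ≠ ∞) (w : F'.submoduleGeneratedBy F.dom)
    (v : F.GenModule) : quotientEquiv hD hle hglb hp w = Submodule.Quotient.mk v ↔
      (w : F'.GenModule) = moduleMap hD hle v := by
  rw [quotientEquiv, LinearIsometryEquiv.trans_apply, LinearIsometryEquiv.symm_apply_eq,
    Subtype.ext_iff]
  rfl

end Quotient

end LpFunctional

open LpFunctional in
theorem mainTheorem2 {M : Type*} [MeasurableSpace M] (m : Measure M) (p : ℝ≥0∞) [Fact (1 ≤ p)]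
    (hp1 : 1 < p) (hp : p ≠ ∞) (F : LpFunctional m p) (hF : F.WeaklyReflexive) :
    ∃ (Fhat : LpFunctional m p) (_ : F.IsLowerRelaxation Fhat) (hD : F.dom ≤ Fhat.dom),
      (∃ Φ : Fhat.submoduleGeneratedBy F.dom ≃ₗᵢ[ℝ] F.GenModule ⧸ F.zeroModule,
        -- the isometry is the natural one: it maps the differential of `f` to that of `f`
        (∀ f : F.dom, ∃ w : Fhat.submoduleGeneratedBy F.dom,
          (w : Fhat.GenModule) = Fhat.d (Submodule.inclusion hD f) ∧
            Φ w = Submodule.Quotient.mk (F.d f)) ∧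
        -- both sides are stable under multiplication by bounded functions, and it commutes with it
        (∀ (a : Lp ℝ ∞ m) (w : Fhat.submoduleGeneratedBy F.dom) (v : F.GenModule),
          Φ w = Submodule.Quotient.mk v →
            ∃ w' : Fhat.submoduleGeneratedBy F.dom,
              (w' : Fhat.GenModule) = Fhat.linftyMul a w ∧
                Φ w' = Submodule.Quotient.mk (F.linftyMul a v)) ∧
        -- it preserves the pointwise norms
        (∀ (w : Fhat.submoduleGeneratedBy F.dom) (v : F.GenModule),
          Φ w = Submodule.Quotient.mk v →
            IsGLB (Set.range fun ω : F.zeroModule => F.pnorm (v + ω)) (Fhat.pnorm w))) ∧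
      ∀ f : F.dom, ‖Fhat.d (Submodule.inclusion hD f)‖ = ⨅ ω : F.zeroModule, ‖F.d f + ω‖ := by
  have hD := dom_le_dom_relaxation hp hF
  have hrel := isLowerRelaxation_relaxation hp hF
  have hglb : ∀ f : F.dom, IsGLB (Set.range fun ω : F.zeroModule => F.pnorm (F.d f + ω))
      ((F.relaxation hp hF).g (Submodule.inclusion hD f)) := fun f => by
    have h := hrel.isGreatest (Submodule.inclusion hD f)
    rwa [Submodule.coe_inclusion,
      lowerBoundsAt_eq_lowerBounds hF (d_mem_relaxedDifferentials f)] at h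
  have hle : ∀ f, (F.relaxation hp hF).g (Submodule.inclusion hD f) ≤ F.g f := fun f => by
    have h := (hglb f).1 ⟨0, rfl⟩
    simpa only [ZeroMemClass.coe_zero, add_zero, pnorm_d] using h
  refine ⟨F.relaxation hp hF, hrel, hD, ⟨quotientEquiv hD hle hglb hp, fun f => ?_,
    fun a w v hw => ?_, fun w v hw => ?_⟩, fun f => ?_⟩
  · refine ⟨⟨_, moduleMap_mem_submoduleGeneratedBy hD hle hp (F.d f)⟩, moduleMap_d hD hle f, ?_⟩
    rw [quotientEquiv_eq_mk_iff]
  · rw [quotientEquiv_eq_mk_iff] at hw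
    refine ⟨⟨_, linftyMul_mem_of_mem_moduleSpan w.2 a⟩, rfl, ?_⟩
    rw [quotientEquiv_eq_mk_iff, moduleMap_linftyMul, ← hw]
  · rw [quotientEquiv_eq_mk_iff] at hw
    rw [hw]
    exact isGLB_pnorm_moduleMap hD hle hglb v
  · rw [← moduleMap_d hD hle]
    exact (isGLB_norm_moduleMap hD hle hglb hp (F.d f)).ciInf_eq.symm
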